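/- Let $(\mathcal S,\mathcal A,P,R,\gamma)$ be a Markov decision process with state space $\mathcal S\subseteq\mathbb R^{p}$, action space $\mathcal A\subseteq\mathbb R^{q}$, discount factor $\gamma\in(0,1)$ and a given initial state distribution; put $d=p+q$ and write $[s;a]\in\mathbb R^d$ for the concatenation of $s$ and $a$. For a (stochastic, Markovian) policy $\pi$ let $\rho^\pi=(1-\gamma)\sum_{t\ge 0}\gamma^t\,\Pr[(S_t,A_t)\in\cdot\mid\pi]$ be its occupancy measure, viewed as a probability measure on $\mathbb R^d$ through $(s,a)\mapsto[s;a]$. For $\sigma>0$ let $k(x,y)=\exp(-\|x-y\|^2/(2\sigma^2))$ be the Gaussian kernel on $\mathbb R^d$, with feature map $\Phi(x)=k(\cdot,x)$ into its reproducing kernel Hilbert space, and let $\mathrm{MMD}(P,Q)=\|\mathbb E_{X\sim P}\Phi(X)-\mathbb E_{Y\sim Q}\Phi(Y)\|$. Let $\phi(x)=\sqrt{2/D}\,\big(\cos(w_i^{T}x+b_i)\big)_{i=1}^{D}$ be random Fourier features, with independent $w_i\sim\mathcal N(0,\sigma^{-2}I)$ and $b_i\sim\mathcal U(0,2\pi)$.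 For a trajectory $\tau=(s_t,a_t)_{t\ge0}$ put $$z(\tau)=(1-\gamma)\sum_{t=0}^{\infty}\gamma^t\phi([s_t;a_t]),\qquad z^{T}(\tau)=(1-\gamma)\sum_{t=0}^{T-1}\gamma^t\phi([s_t;a_t]).$$ There are universal constants $c_1>0$ and $C>0$ such that the following holds for every such process, any two policies $\pi_1,\pi_2$ with occupancy measures $P,Q$, and all $\sigma>0$, $n\ge1$, $D\ge1$, $\varepsilon>0$. Draw $n$ independent trajectories of $\pi_1$ and $n$ independent trajectories of $\pi_2$, independently of each other and of the features $(w_i,b_i)_i$. Let $\psi_P,\psi_Q$ be the averages of $z$, and $\psi^T_P,\psi^T_Q$ the averages of $z^T$, over the $n$ trajectories of $\pi_1$, respectively $\pi_2$. Put $$B=2e^{-nc_1\varepsilon^2}+\frac{C}{\varepsilon^2}\exp\!\Big(\frac{-D\varepsilon^2}{64(d+2)}\Big)+6e^{-n\varepsilon^2/8}+8e^{-n\varepsilon^2/64}.$$ 1. (Infinite horizon.) $\Pr\big[\,\big|\|\psi_P-\psi_Q\|_2-\mathrm{MMD}(P,Q)\big|\ge\tfrac{11}{4}\varepsilon\,\big]\le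 B.$ 2. (Finite horizon.) For every $T\ge0$, $\Pr\big[\,\big|\|\psi^T_P-\psi^T_Q\|_2-\mathrm{MMD}(P,Q)\big|\ge\tfrac{11}{4}\varepsilon+2\sqrt2\,\gamma^T\,\big]\le B.$ Moreover, for every realization of the features, $\|\mathbb E_{\pi_1}[z]-\mathbb E_{\pi_1}[z^T]\|_2+\|\mathbb E_{\pi_2}[z]-\mathbb E_{\pi_2}[z^T]\|_2\le2\sqrt2\,\gamma^T$, where $\mathbb E_{\pi_i}$ is the expectation over a trajectory of $\pi_i$. -/

import Mathlib

open MeasureTheory ProbabilityTheory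
open scoped ENNReal

/-! ### The Gaussian kernel, its reproducing kernel Hilbert space, and the MMD -/

/-- The Gaussian kernel `k(x, y) = exp(-‖x - y‖² / (2σ²))` on `ℝᵈ`. -/
noncomputable def gaussianKernel {d : ℕ} (σ : ℝ) (x y : EuclideanSpace ℝ (Fin d)) : ℝ :=
  Real.exp (-‖x - y‖ ^ 2 / (2 * σ ^ 2))

/-- The Gaussian kernel in the operator-valued format of Mathlib's `RKHS`: the real number `k(x, y)`
is read as the operator of multiplication by `k(x, y)` on `ℝ`. -/
noncomputable def gaussianKernelOp (d : ℕ) (σ : ℝ) :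
    Matrix (EuclideanSpace ℝ (Fin d)) (EuclideanSpace ℝ (Fin d)) (ℝ →L[ℝ] ℝ) :=
  Matrix.of fun x y => gaussianKernel σ x y • ContinuousLinearMap.id ℝ ℝ

/-- The Gaussian kernel as the average of `cos ⟨u, σ⁻¹(x - y)⟩` over a standard Gaussian `u`. -/
theorem gaussianKernel_eq_integral {d : ℕ} (σ : ℝ) (x y : EuclideanSpace ℝ (Fin d)) :
    gaussianKernel σ x y
      = ∫ u, Real.cos (inner ℝ u (σ⁻¹ • (x - y))) ∂(stdGaussian (EuclideanSpace ℝ (Fin d))) := by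
  have h := charFun_stdGaussian (E := EuclideanSpace ℝ (Fin d)) (σ⁻¹ • (x - y))
  rw [charFun_apply] at h
  have hint : Integrable
      (fun u => Complex.exp (((inner ℝ u (σ⁻¹ • (x - y)) : ℝ) : ℂ) * Complex.I))
      (stdGaussian (EuclideanSpace ℝ (Fin d))) := by
    refine Integrable.of_bound (by fun_prop) 1 (.of_forall fun u => ?_)
    simp [Complex.norm_exp_ofReal_mul_I]
  have h2 := congrArg Complex.re h
  have h3 := integral_re hint
  simp only [RCLike.re_eq_complex_re] at h3
  rw [← h3] at h2
  simp only [Complex.exp_ofReal_mul_I_re] at h2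
  rw [h2, gaussianKernel]
  have h4 : (-((‖σ⁻¹ • (x - y)‖ : ℝ) : ℂ) ^ 2 / 2)
      = ((-‖σ⁻¹ • (x - y)‖ ^ 2 / 2 : ℝ) : ℂ) := by push_cast; ring
  rw [h4, Complex.exp_ofReal_re, norm_smul, mul_pow, norm_inv, inv_pow, Real.norm_eq_abs, sq_abs]
  congr 1
  by_cases hσ : σ = 0
  · simp [hσ]
  · field_simp

open scoped ComplexOrder in
theorem gaussianKernelOp_posSemidef (d : ℕ) (σ : ℝ) : (gaussianKernelOp d σ).PosSemidef := by
  have htfae := (RKHS.posSemidef_tfae (K := gaussianKernelOp d σ)).out 0 2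
  refine htfae.2 ⟨?_, fun v => ?_⟩
  · ext x y
    simp only [gaussianKernelOp, gaussianKernel, Matrix.conjTranspose_apply, Matrix.of_apply,
      norm_sub_rev x y, star_smul, star_trivial, ContinuousLinearMap.star_eq_adjoint]
    rw [show (ContinuousLinearMap.id ℝ ℝ).adjoint = ContinuousLinearMap.id ℝ ℝ from
      star_one (R := ℝ →L[ℝ] ℝ)]
  · simp only [RCLike.re_to_real, Finsupp.sum, gaussianKernelOp, Matrix.of_apply]
    set μ := stdGaussian (EuclideanSpace ℝ (Fin d)) with hμ
    have key : ∀ x y : EuclideanSpace ℝ (Fin d),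
        inner ℝ ((gaussianKernel σ y x • ContinuousLinearMap.id ℝ ℝ) (v x)) (v y)
        = ∫ u, ((v x * Real.cos (inner ℝ u (σ⁻¹ • x))) * (v y * Real.cos (inner ℝ u (σ⁻¹ • y)))
          + (v x * Real.sin (inner ℝ u (σ⁻¹ • x))) * (v y * Real.sin (inner ℝ u (σ⁻¹ • y)))) ∂μ := by
      intro x y
      have : ∀ u : EuclideanSpace ℝ (Fin d),
          (v x * Real.cos (inner ℝ u (σ⁻¹ • x))) * (v y * Real.cos (inner ℝ u (σ⁻¹ • y)))
          + (v x * Real.sin (inner ℝ u (σ⁻¹ • x))) * (v y * Real.sin (inner ℝ u (σ⁻¹ • y)))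
          = (v x * v y) * Real.cos (inner ℝ u (σ⁻¹ • (y - x))) := by
        intro u
        rw [smul_sub, inner_sub_right, Real.cos_sub]
        ring
      simp only [this, integral_const_mul, hμ, ← gaussianKernel_eq_integral]
      simp
      ring
    have hint : ∀ x y : EuclideanSpace ℝ (Fin d), Integrable (fun u =>
        (v x * Real.cos (inner ℝ u (σ⁻¹ • x))) * (v y * Real.cos (inner ℝ u (σ⁻¹ • y)))
          + (v x * Real.sin (inner ℝ u (σ⁻¹ • x))) * (v y * Real.sin (inner ℝ u (σ⁻¹ • y)))) μ := by
      intro x y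
      have : ∀ u : EuclideanSpace ℝ (Fin d),
          (v x * Real.cos (inner ℝ u (σ⁻¹ • x))) * (v y * Real.cos (inner ℝ u (σ⁻¹ • y)))
          + (v x * Real.sin (inner ℝ u (σ⁻¹ • x))) * (v y * Real.sin (inner ℝ u (σ⁻¹ • y)))
          = (v x * v y) * Real.cos (inner ℝ u (σ⁻¹ • (y - x))) := by
        intro u
        rw [smul_sub, inner_sub_right, Real.cos_sub]
        ring
      simp only [this]
      refine Integrable.const_mul ?_ _
      refine Integrable.of_bound (by fun_prop) 1 (.of_forall fun u => ?_)
      simpa using Real.abs_cos_le_one _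
    simp only [key]
    have swap : (∑ x ∈ v.support, ∑ y ∈ v.support, ∫ u,
        ((v x * Real.cos (inner ℝ u (σ⁻¹ • x))) * (v y * Real.cos (inner ℝ u (σ⁻¹ • y)))
          + (v x * Real.sin (inner ℝ u (σ⁻¹ • x))) * (v y * Real.sin (inner ℝ u (σ⁻¹ • y)))) ∂μ)
        = ∫ u, ((∑ x ∈ v.support, v x * Real.cos (inner ℝ u (σ⁻¹ • x))) ^ 2
          + (∑ x ∈ v.support, v x * Real.sin (inner ℝ u (σ⁻¹ • x))) ^ 2) ∂μ := by
      have h1 : ∀ x ∈ v.support, (∑ y ∈ v.support, ∫ u,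
          ((v x * Real.cos (inner ℝ u (σ⁻¹ • x))) * (v y * Real.cos (inner ℝ u (σ⁻¹ • y)))
          + (v x * Real.sin (inner ℝ u (σ⁻¹ • x))) * (v y * Real.sin (inner ℝ u (σ⁻¹ • y)))) ∂μ)
          = ∫ u, ∑ y ∈ v.support,
          ((v x * Real.cos (inner ℝ u (σ⁻¹ • x))) * (v y * Real.cos (inner ℝ u (σ⁻¹ • y)))
          + (v x * Real.sin (inner ℝ u (σ⁻¹ • x))) * (v y * Real.sin (inner ℝ u (σ⁻¹ • y)))) ∂μ :=
        fun x _ => (integral_finsetSum _ fun y _ => hint x y).symm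
      rw [Finset.sum_congr rfl h1,
        ← integral_finsetSum _ fun x _ => integrable_finsetSum _ fun y _ => hint x y]
      refine integral_congr_ae (.of_forall fun u => ?_)
      simp only [sq, Finset.sum_mul_sum, ← Finset.sum_add_distrib]
    rw [swap]
    exact integral_nonneg fun u => by positivity

open scoped ComplexOrder in
instance gaussianKernelOp_fact (d : ℕ) (σ : ℝ) : Fact (gaussianKernelOp d σ).PosSemidef :=
  ⟨gaussianKernelOp_posSemidef d σ⟩

/-- The reproducing kernel Hilbert space of the Gaussian kernel of width `σ` on `ℝᵈ`. -/
abbrev GaussianRKHS (d : ℕ) (σ : ℝ) : Type := RKHS.OfKernel (gaussianKernelOp d σ)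

/-- The canonical feature map `x ↦ k(·, x)` of the Gaussian kernel. -/
noncomputable def gaussianFeature {d : ℕ} (σ : ℝ) (x : EuclideanSpace ℝ (Fin d)) :
    GaussianRKHS d σ :=
  RKHS.kerFun (GaussianRKHS d σ) x (1 : ℝ)

theorem inner_gaussianFeature {d : ℕ} (σ : ℝ) (x y : EuclideanSpace ℝ (Fin d)) :
    inner ℝ (gaussianFeature σ x) (gaussianFeature σ y) = gaussianKernel σ x y := by
  have h := RKHS.kernel_inner (GaussianRKHS d σ) y x (1 : ℝ) (1 : ℝ)
  rw [RKHS.OfKernel.kernel_ofKernel] at h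
  rw [gaussianFeature, gaussianFeature, ← h]
  simp [gaussianKernelOp, gaussianKernel, norm_sub_rev x y]

/-- The maximum mean discrepancy `‖E_{X∼P} Φ(X) - E_{Y∼Q} Φ(Y)‖`, where `Φ` is the feature map of
the Gaussian kernel of width `σ`. -/
noncomputable def gaussianMMD {d : ℕ} (σ : ℝ) (P Q : Measure (EuclideanSpace ℝ (Fin d))) : ℝ :=
  ‖(∫ x, gaussianFeature σ x ∂P) - ∫ y, gaussianFeature σ y ∂Q‖

/-! ### Markov decision processes, trajectories and occupancy measures -/

/-- A discounted Markov decision process with state space `S` and action space `A`, together with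
the distribution of the initial state. -/
structure MDP (S A : Type*) [MeasurableSpace S] [MeasurableSpace A] where
  /-- transition probabilities `P(s' | s, a)` -/
  transition : Kernel (S × A) S
  /-- reward function -/
  reward : S × A → ℝ
  /-- discount factor -/
  discount : ℝ
  /-- distribution of the initial state -/
  init : Measure S
  markov_transition : IsMarkovKernel transition
  prob_init : IsProbabilityMeasure init
  discount_pos : 0 < discount
  discount_lt_one : discount < 1

namespace MDP

attribute [instance] MDP.markov_transition MDP.prob_init

variable {S A : Type*} [MeasurableSpace S] [MeasurableSpace A]

/-- One step of the state-action process under the policy `π`, given the history up to time `t`: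
the next state is drawn from the transition probabilities at the current state-action pair and the
next action from `π` at the next state. -/
noncomputable def step (M : MDP S A) (π : Kernel S A) (t : ℕ) :
    Kernel (Finset.Iic t → S × A) (S × A) :=
  (M.transition.compProd (Kernel.prodMkLeft (S × A) π)).comap
    (fun h => h ⟨t, Finset.mem_Iic.2 le_rfl⟩) (measurable_pi_apply _)

instance isMarkovKernel_step (M : MDP S A) (π : Kernel S A) [IsMarkovKernel π] (t : ℕ) :
    IsMarkovKernel (M.step π t) := by
  unfold step
  infer_instance

/-- The law of the infinite trajectory `(S₀, A₀), (S₁, A₁), …` under the policy `π`. -/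
noncomputable def trajectoryLaw (M : MDP S A) (π : Kernel S A) [IsMarkovKernel π] :
    Measure (ℕ → S × A) :=
  Kernel.trajMeasure (X := fun _ => S × A) (M.init.compProd π) (M.step π)

instance isProbabilityMeasure_trajectoryLaw (M : MDP S A) (π : Kernel S A) [IsMarkovKernel π] :
    IsProbabilityMeasure (M.trajectoryLaw π) := by
  unfold trajectoryLaw
  infer_instance

/-- The occupancy measure `ρ^π = (1 - γ) ∑ₜ γᵗ P((Sₜ, Aₜ) ∈ · | π)`. -/
noncomputable def occupancy (M : MDP S A) (π : Kernel S A) [IsMarkovKernel π] : Measure (S × A) :=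
  Measure.sum fun t : ℕ => ENNReal.ofReal ((1 - M.discount) * M.discount ^ t) •
    (M.trajectoryLaw π).map (fun τ => τ t)

end MDP

/-! ### Random Fourier features and trajectory embeddings -/

/-- The concatenation `[s; a]` of a state vector and an action vector. -/
noncomputable def concat {p q : ℕ} {S : Set (EuclideanSpace ℝ (Fin p))}
    {A : Set (EuclideanSpace ℝ (Fin q))} (x : S × A) : EuclideanSpace ℝ (Fin (p + q)) :=
  WithLp.toLp 2 (Fin.append (x.1 : EuclideanSpace ℝ (Fin p)) (x.2 : EuclideanSpace ℝ (Fin q)))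

theorem measurable_concat {p q : ℕ} {S : Set (EuclideanSpace ℝ (Fin p))}
    {A : Set (EuclideanSpace ℝ (Fin q))} :
    Measurable (concat : S × A → EuclideanSpace ℝ (Fin (p + q))) := by
  refine (WithLp.measurable_toLp 2 _).comp (measurable_pi_iff.2 fun i => ?_)
  refine Fin.addCases (fun i => ?_) (fun i => ?_) i
  · simp only [Fin.append_left]
    fun_prop
  · simp only [Fin.append_right]
    fun_prop

/-- The feature map `φ(x) = √(2/D) (cos(⟨wᵢ, x⟩ + bᵢ))_{i < D}` with parameters
`θ i = (wᵢ, bᵢ)`. -/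
noncomputable def fourierFeature {d D : ℕ} (θ : Fin D → EuclideanSpace ℝ (Fin d) × ℝ)
    (x : EuclideanSpace ℝ (Fin d)) : EuclideanSpace ℝ (Fin D) :=
  WithLp.toLp 2 fun i => Real.sqrt (2 / D) * Real.cos (inner ℝ (θ i).1 x + (θ i).2)

/-- The law of one feature parameter `(w, b)`: independent `w ∼ N(0, σ⁻² I)` and
`b ∼ U(0, 2π)`. -/
noncomputable def featureLaw (d : ℕ) (σ : ℝ) : Measure (EuclideanSpace ℝ (Fin d) × ℝ) :=
  (multivariateGaussian 0 ((σ ^ 2)⁻¹ • (1 : Matrix (Fin d) (Fin d) ℝ))).prod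
    (cond volume (Set.Icc 0 (2 * Real.pi)))

section Embedding

variable {p q D : ℕ} {S : Set (EuclideanSpace ℝ (Fin p))} {A : Set (EuclideanSpace ℝ (Fin q))}

/-- The trajectory feature `z = (1 - γ) ∑_{t ≥ 0} γᵗ φ(sₜ, aₜ)`. -/
noncomputable def trajFeature (γ : ℝ) (θ : Fin D → EuclideanSpace ℝ (Fin (p + q)) × ℝ)
    (τ : ℕ → S × A) : EuclideanSpace ℝ (Fin D) :=
  (1 - γ) • ∑' t : ℕ, γ ^ t • fourierFeature θ (concat (τ t))

/-- The feature `z^T = (1 - γ) ∑_{t=0}^{T-1} γᵗ φ(sₜ, aₜ)` of a trajectory truncated to its first `T`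
steps. -/
noncomputable def truncTrajFeature (γ : ℝ) (T : ℕ)
    (θ : Fin D → EuclideanSpace ℝ (Fin (p + q)) × ℝ) (τ : ℕ → S × A) :
    EuclideanSpace ℝ (Fin D) :=
  (1 - γ) • ∑ t ∈ Finset.range T, γ ^ t • fourierFeature θ (concat (τ t))

/-- The policy embedding `ψ`: the mean of the trajectory features of `n` trajectories. -/
noncomputable def embedding {n : ℕ} (γ : ℝ) (θ : Fin D → EuclideanSpace ℝ (Fin (p + q)) × ℝ)
    (τ : Fin n → ℕ → S × A) : EuclideanSpace ℝ (Fin D) :=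
  (n : ℝ)⁻¹ • ∑ j, trajFeature γ θ (τ j)

/-- The policy embedding `ψ^T` computed from `n` trajectories truncated to `T` steps. -/
noncomputable def truncEmbedding {n : ℕ} (γ : ℝ) (T : ℕ)
    (θ : Fin D → EuclideanSpace ℝ (Fin (p + q)) × ℝ) (τ : Fin n → ℕ → S × A) :
    EuclideanSpace ℝ (Fin D) :=
  (n : ℝ)⁻¹ • ∑ j, truncTrajFeature γ T θ (τ j)

end Embedding

/-- The right-hand side of the tail bound, with `c₁` and `C` the two unspecified constants:
`2 e^{-n c₁ ε²} + C ε⁻² e^{-Dε²/(64(d+2))} + 6 e^{-nε²/8} + 8 e^{-nε²/64}`. -/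
noncomputable def tailBound (c₁ C : ℝ) (n D d : ℕ) (ε : ℝ) : ℝ :=
  2 * Real.exp (-(n * c₁ * ε ^ 2))
    + C * (1 / ε ^ 2 * Real.exp (-(D * ε ^ 2) / (64 * (d + 2))))
    + 6 * Real.exp (-(n * ε ^ 2) / 8)
    + 8 * Real.exp (-(n * ε ^ 2) / 64)

/-!
The product-to-sum formula and the characteristic function of the Gaussian give
`k(x, y) = 𝔼 [√2 cos(⟨w, x⟩ + b) · √2 cos(⟨w, y⟩ + b)]`. Hence the squared MMD is the mean, over a
random feature, of the squared gap between the expectations of that feature under `P` and `Q`, while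
the squared distance between the two mean embeddings is the average of the same quantity over the
`D` sampled features. A Chernoff bound on the scale of the square root compares the two, with no
covering argument and so with no loss in the dimension. For fixed features, the distance of the
averages over `n` trajectories from the mean embeddings has mean at most `√2 / √n` for each policy,
and bounded differences concentrate it around that mean. Truncation moves every embedding by at most
`√2 γᵀ`. Where `n ε²` is too small for the mean deviation to be absorbed, the tail bound exceeds
`1`, and for `ε > 2` the event is empty.
-/

open scoped NNReal

section ProbabilityIntegral

variable {X V : Type*} [MeasurableSpace X] [NormedAddCommGroup V] [NormedSpace ℝ V]
  {μ : Measure X} [IsProbabilityMeasure μ] {f g : X → V} {K : ℝ}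

theorem norm_integral_le_of_forall_norm_le (hf : ∀ x, ‖f x‖ ≤ K) : ‖∫ x, f x ∂μ‖ ≤ K := by
  simpa using norm_integral_le_of_norm_le_const (μ := μ) (.of_forall hf)

theorem norm_integral_sub_integral_le_of_forall_norm_sub_le (hf : Integrable f μ)
    (hg : Integrable g μ) (hfg : ∀ x, ‖f x - g x‖ ≤ K) :
    ‖(∫ x, f x ∂μ) - ∫ x, g x ∂μ‖ ≤ K := by
  rw [← integral_sub hf hg]
  exact norm_integral_le_of_forall_norm_le hfg

end ProbabilityIntegral

theorem integrable_prod_of_integral_norm_le {X Y V : Type*} [MeasurableSpace X] [MeasurableSpace Y]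
    [NormedAddCommGroup V] {μ : Measure X} {ν : Measure Y} [SFinite ν]
    {f : X × Y → V} (hf : AEStronglyMeasurable f (μ.prod ν)) {G : X → ℝ}
    (hsection : ∀ x, Integrable (fun y => f (x, y)) ν) (hG : Integrable G μ)
    (hfG : ∀ x, ∫ y, ‖f (x, y)‖ ∂ν ≤ G x) : Integrable f (μ.prod ν) := by
  refine (integrable_prod_iff hf).2 ⟨.of_forall hsection,
    hG.mono' hf.norm.integral_prod_right' (.of_forall fun x => ?_)⟩
  rw [Real.norm_of_nonneg (integral_nonneg fun y => norm_nonneg _)]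
  exact hfG x

section BoundedDifferences

theorem integrable_of_hasSubgaussianMGF_sub_const {X : Type*} [MeasurableSpace X] {μ : Measure X}
    [IsFiniteMeasure μ] {f : X → ℝ} {m : ℝ} {c : ℝ≥0}
    (hf : HasSubgaussianMGF (fun x => f x - m) c μ) : Integrable f μ := by
  simpa [Pi.add_def] using hf.integrable.add (integrable_const m)

theorem hasSubgaussianMGF_of_abs_sub_le {X : Type*} [MeasurableSpace X] {μ : Measure X}
    [IsProbabilityMeasure μ] {f : X → ℝ} (hf : Measurable f) {c : ℝ≥0}
    (hosc : ∀ x y, |f x - f y| ≤ c) :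
    HasSubgaussianMGF (fun x => f x - ∫ y, f y ∂μ) ((c / 2) ^ 2) μ := by
  have : Nonempty X := μ.nonempty_of_neZero
  have hbdd : BddBelow (Set.range f) := by
    refine ⟨f (Classical.arbitrary X) - c, ?_⟩
    rintro _ ⟨x, rfl⟩
    linarith [(abs_le.1 (hosc x (Classical.arbitrary X))).1]
  have hmem : ∀ x, f x ∈ Set.Icc (⨅ y, f y) ((⨅ y, f y) + c) := fun x =>
    ⟨ciInf_le hbdd x, sub_le_iff_le_add.1 <| le_ciInf fun y => by
      linarith [(abs_le.1 (hosc x y)).2]⟩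
  simpa using hasSubgaussianMGF_of_mem_Icc (μ := μ) hf.aemeasurable (.of_forall hmem)

theorem hasSubgaussianMGF_prod {X Y : Type*} [MeasurableSpace X] [MeasurableSpace Y]
    {μ : Measure X} [IsProbabilityMeasure μ] {ν : Measure Y} [IsProbabilityMeasure ν]
    {f : X × Y → ℝ} (hf : Measurable f) {a b : ℝ≥0}
    (hmean : HasSubgaussianMGF
      (fun x => ∫ y, f (x, y) ∂ν - ∫ x', ∫ y, f (x', y) ∂ν ∂μ) a μ)
    (hsection : ∀ x, HasSubgaussianMGF (fun y => f (x, y) - ∫ y', f (x, y') ∂ν) b ν) :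
    HasSubgaussianMGF (fun z => f z - ∫ z', f z' ∂μ.prod ν) (a + b) (μ.prod ν) := by
  set m := ∫ x', ∫ y, f (x', y) ∂ν ∂μ with hm
  have hsplit : ∀ t x y, Real.exp (t * (f (x, y) - m))
      = Real.exp (t * (∫ y', f (x, y') ∂ν - m))
        * Real.exp (t * (f (x, y) - ∫ y', f (x, y') ∂ν)) := fun t x y => by
    rw [← Real.exp_add]
    ring_nf
  have hinner : ∀ t x, ∫ y, Real.exp (t * (f (x, y) - m)) ∂ν
      ≤ Real.exp (t * (∫ y', f (x, y') ∂ν - m)) * Real.exp (b * t ^ 2 / 2) := fun t x => by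
    simp only [hsplit, integral_const_mul]
    gcongr
    exact (hsection x).mgf_le t
  have hmajor : ∀ t, Integrable
      (fun x => Real.exp (t * (∫ y', f (x, y') ∂ν - m)) * Real.exp (b * t ^ 2 / 2)) μ :=
    fun t => (hmean.integrable_exp_mul t).mul_const _
  have hint : ∀ t, Integrable (fun z => Real.exp (t * (f z - m))) (μ.prod ν) := fun t => by
    refine integrable_prod_of_integral_norm_le (by fun_prop) (fun x => ?_) (hmajor t) fun x => ?_
    · simp only [hsplit]
      exact ((hsection x).integrable_exp_mul t).const_mul _
    · simpa only [Real.norm_of_nonneg (Real.exp_pos _).le] using hinner t x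
  have hsubG : HasSubgaussianMGF (fun z => f z - m) (a + b) (μ.prod ν) := by
    refine ⟨hint, fun t => ?_⟩
    calc mgf (fun z => f z - m) (μ.prod ν) t
        = ∫ x, ∫ y, Real.exp (t * (f (x, y) - m)) ∂ν ∂μ := integral_prod _ (hint t)
      _ ≤ ∫ x, Real.exp (t * (∫ y', f (x, y') ∂ν - m)) * Real.exp (b * t ^ 2 / 2) ∂μ :=
          integral_mono (hint t).integral_prod_left (hmajor t) (hinner t)
      _ ≤ Real.exp (a * t ^ 2 / 2) * Real.exp (b * t ^ 2 / 2) := by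
          rw [integral_mul_const]
          gcongr
          exact hmean.mgf_le t
      _ = Real.exp ((a + b : ℝ≥0) * t ^ 2 / 2) := by
          rw [← Real.exp_add]
          push_cast
          ring_nf
  rwa [hm, ← integral_prod f (integrable_of_hasSubgaussianMGF_sub_const hsubG)] at hsubG

theorem hasSubgaussianMGF_pi_of_boundedDifferences {n : ℕ} {X : Fin n → Type*}
    [∀ i, MeasurableSpace (X i)] (μ : ∀ i, Measure (X i)) [∀ i, IsProbabilityMeasure (μ i)]
    {f : (∀ i, X i) → ℝ} (hf : Measurable f) {c : Fin n → ℝ≥0}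
    (hdiff : ∀ x i y, |f (Function.update x i y) - f x| ≤ c i) :
    HasSubgaussianMGF (fun x => f x - ∫ y, f y ∂Measure.pi μ) (∑ i, (c i / 2) ^ 2)
      (Measure.pi μ) := by
  induction n with
  | zero =>
    have hzero : (fun x => f x - ∫ y, f y ∂Measure.pi μ) = fun _ => 0 := funext fun x => by
      rw [Measure.pi_of_empty μ x, integral_dirac, sub_self]
    rw [hzero, Finset.univ_eq_empty, Finset.sum_empty]
    exact .fun_zero
  | succ n ih =>
    set μ' : ∀ i : Fin n, Measure (X (Fin.succAbove 0 i)) := fun i => μ (Fin.succAbove 0 i)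
    have hsplit := measurePreserving_piFinSuccAbove μ 0
    set e := MeasurableEquiv.piFinSuccAbove X 0
    have he : ∀ x xs, e.symm (x, xs) = Fin.insertNth 0 x xs := fun _ _ => rfl
    have hfe : Measurable fun z => f (e.symm z) := hf.comp e.symm.measurable
    have hsection : ∀ x, HasSubgaussianMGF
        (fun xs => f (e.symm (x, xs)) - ∫ ys, f (e.symm (x, ys)) ∂Measure.pi μ')
        (∑ i : Fin n, (c (Fin.succAbove 0 i) / 2) ^ 2) (Measure.pi μ') := fun x =>
      ih μ' (hfe.comp measurable_prodMk_left) fun xs i y => by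
        simpa only [Function.comp_apply, he, Fin.insertNth_update] using
          hdiff (e.symm (x, xs)) (Fin.succAbove 0 i) y
    have hosc : ∀ x x', |∫ xs, f (e.symm (x, xs)) ∂Measure.pi μ'
        - ∫ xs, f (e.symm (x', xs)) ∂Measure.pi μ'| ≤ c 0 := fun x x' =>
      norm_integral_sub_integral_le_of_forall_norm_sub_le
        (integrable_of_hasSubgaussianMGF_sub_const (hsection x))
        (integrable_of_hasSubgaussianMGF_sub_const (hsection x')) fun xs => by
          simpa only [he, Fin.update_insertNth, Real.norm_eq_abs] using hdiff (e.symm (x', xs)) 0 x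
    have hmean := hasSubgaussianMGF_of_abs_sub_le (μ := μ 0)
      hfe.stronglyMeasurable.integral_prod_right'.measurable hosc
    have hprod := hasSubgaussianMGF_prod hfe hmean hsection
    rw [Fin.sum_univ_succAbove _ 0, ← hsplit.symm.integral_comp']
    have hpi := HasSubgaussianMGF.of_map (μ := Measure.pi μ) e.measurable.aemeasurable
      (by rwa [hsplit.map_eq])
    simpa only [Function.comp_def, e.symm_apply_apply] using hpi

end BoundedDifferences

section SampleMean

variable {V : Type*} [NormedAddCommGroup V] [NormedSpace ℝ V] {n : ℕ}

/-- The empirical mean of a sample of `n` vectors; it is `0` when `n = 0`. -/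
noncomputable def sampleMean (v : Fin n → V) : V :=
  (n : ℝ)⁻¹ • ∑ j, v j

theorem sampleMean_sub (v w : Fin n → V) :
    sampleMean v - sampleMean w = sampleMean fun j => v j - w j := by
  simp only [sampleMean, ← smul_sub, Finset.sum_sub_distrib]

theorem norm_sampleMean_le {v : Fin n → V} {K : ℝ} (hK : 0 ≤ K) (hv : ∀ j, ‖v j‖ ≤ K) :
    ‖sampleMean v‖ ≤ K := by
  rw [sampleMean, norm_smul, norm_inv, Real.norm_natCast]
  refine inv_mul_le_of_le_mul₀ n.cast_nonneg hK ((norm_sum_le _ _).trans ?_)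
  simpa using Finset.sum_le_card_nsmul Finset.univ (fun j => ‖v j‖) K fun j _ => hv j

theorem stronglyMeasurable_sampleMean {Y : Type*} [MeasurableSpace Y] {v : Y → Fin n → V}
    (hv : ∀ j, StronglyMeasurable fun y => v y j) : StronglyMeasurable fun y => sampleMean (v y) :=
  (Finset.stronglyMeasurable_fun_sum _ fun j _ => hv j).const_smul _

theorem measurable_norm_sampleMean_sub {X : Type*} [MeasurableSpace X] {z : X → V}
    (hz : StronglyMeasurable z) (m : V) :
    Measurable fun x : Fin n → X => ‖sampleMean (fun j => z (x j)) - m‖ :=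
  ((stronglyMeasurable_sampleMean fun j => hz.comp_measurable (measurable_pi_apply j)).sub
    stronglyMeasurable_const).norm.measurable

theorem abs_norm_sampleMean_update_sub_sub_le {X : Type*} {z : X → V} {K : ℝ}
    (hK : ∀ x, ‖z x‖ ≤ K) (m : V) (x : Fin n → X) (i : Fin n) (y : X) :
    |‖sampleMean (fun j => z (Function.update x i y j)) - m‖ - ‖sampleMean (fun j => z (x j)) - m‖|
      ≤ 2 * K / n := by
  have hone : ∑ j, (z (Function.update x i y j) - z (x j)) = z y - z (x i) := by
    rw [Finset.sum_eq_single_of_mem i (Finset.mem_univ i) fun j _ hj => by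
      rw [Function.update_of_ne hj, sub_self], Function.update_self]
  refine (abs_norm_sub_norm_le _ _).trans ?_
  rw [sub_sub_sub_cancel_right, sampleMean_sub, sampleMean, hone, norm_smul, norm_inv,
    Real.norm_natCast, inv_mul_eq_div]
  gcongr
  linarith [norm_sub_le (z y) (z (x i)), hK y, hK (x i)]

end SampleMean

section HilbertConcentration

variable {H : Type*} [NormedAddCommGroup H] [InnerProductSpace ℝ H]

theorem integrable_inner_of_memLp_two {X : Type*} [MeasurableSpace X] {μ : Measure X} {f g : X → H}
    (hf : MemLp f 2 μ) (hg : MemLp g 2 μ) : Integrable (fun x => inner ℝ (f x) (g x)) μ := by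
  refine (hf.norm.integrable_mul hg.norm).mono (hf.1.inner hg.1) (.of_forall fun x => ?_)
  simpa using norm_inner_le_norm (𝕜 := ℝ) (f x) (g x)

variable [CompleteSpace H]

theorem integral_norm_sub_integral_sq {X : Type*} [MeasurableSpace X] {μ : Measure X}
    [IsProbabilityMeasure μ] {f : X → H} (hf : MemLp f 2 μ) :
    ∫ x, ‖f x - ∫ y, f y ∂μ‖ ^ 2 ∂μ = ∫ x, ‖f x‖ ^ 2 ∂μ - ‖∫ x, f x ∂μ‖ ^ 2 := by
  have hfi : Integrable f μ := hf.integrable one_le_two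
  set m := ∫ y, f y ∂μ
  have hinner : ∫ x, inner ℝ m (f x) ∂μ = ‖m‖ ^ 2 := by
    rw [integral_inner hfi, real_inner_self_eq_norm_sq]
  simp only [norm_sub_sq_real, real_inner_comm m]
  rw [integral_add, integral_sub, integral_const_mul, hinner, integral_const]
  · rw [probReal_univ, one_smul]
    ring
  · exact hf.integrable_norm_pow two_ne_zero
  · exact (hfi.const_inner m).const_mul 2
  · exact (hf.integrable_norm_pow two_ne_zero).sub ((hfi.const_inner m).const_mul 2)
  · exact integrable_const _

theorem integral_norm_sum_sq_pi {ι : Type*} [Fintype ι] {X : ι → Type*}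
    [∀ i, MeasurableSpace (X i)] (μ : ∀ i, Measure (X i)) [∀ i, IsProbabilityMeasure (μ i)]
    {z : ∀ i, X i → H} (hz : ∀ i, MemLp (z i) 2 (μ i)) (hmean : ∀ i, ∫ y, z i y ∂μ i = 0) :
    ∫ x, ‖∑ i, z i (x i)‖ ^ 2 ∂Measure.pi μ = ∑ i, ∫ y, ‖z i y‖ ^ 2 ∂μ i := by
  have hL : ∀ i, MemLp (fun x : ∀ i, X i => z i (x i)) 2 (Measure.pi μ) := fun i =>
    (hz i).comp_measurePreserving (measurePreserving_eval μ i)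
  have hoff : ∀ i j, i ≠ j → ∫ x, inner ℝ (z i (x i)) (z j (x j)) ∂Measure.pi μ = 0 := by
    intro i j hij
    have hindep : IndepFun (Function.eval i) (Function.eval j) (Measure.pi μ) :=
      (iIndepFun_pi (X := fun _ => id) fun _ => aemeasurable_id).indepFun hij
    have heval := fun i => measurePreserving_eval μ i
    have hint : ∀ i, Integrable (z i) ((Measure.pi μ).map (Function.eval i)) := fun i => by
      rw [(heval i).map_eq]
      exact (hz i).integrable one_le_two
    calc ∫ x, inner ℝ (z i (x i)) (z j (x j)) ∂Measure.pi μ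
        = inner ℝ (∫ x, z i (x i) ∂Measure.pi μ) (∫ x, z j (x j) ∂Measure.pi μ) :=
          hindep.integral_bilin_comp_comp (heval i).aemeasurable (heval j).aemeasurable (hint i)
            (hint j) (innerSL ℝ)
      _ = 0 := by
          rw [integral_comp_eval (hz i).1, hmean i, inner_zero_left]
  have hinner : ∀ i j, Integrable (fun x => inner ℝ (z i (x i)) (z j (x j))) (Measure.pi μ) :=
    fun i j => integrable_inner_of_memLp_two (hL i) (hL j)
  simp only [← real_inner_self_eq_norm_sq, sum_inner, inner_sum]
  rw [integral_finsetSum _ fun i _ => integrable_finsetSum _ fun j _ => hinner j i]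
  refine Finset.sum_congr rfl fun i _ => ?_
  rw [integral_finsetSum _ fun j _ => hinner j i,
    Finset.sum_eq_single_of_mem i (Finset.mem_univ i) fun j _ hj => hoff j i hj]
  exact integral_comp_eval (f := fun y => inner ℝ (z i y) (z i y)) ((hz i).1.inner (hz i).1)

section IdenticallyDistributed

variable {X : Type*} [MeasurableSpace X] (ν : Measure X) [IsProbabilityMeasure ν] {n : ℕ}
  {z : X → H} {K : ℝ}

theorem integral_norm_sampleMean_sub_sq_le (hz : StronglyMeasurable z) (hK : ∀ x, ‖z x‖ ≤ K)
    (hn : n ≠ 0) :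
    ∫ x, ‖sampleMean (fun j => z (x j)) - ∫ y, z y ∂ν‖ ^ 2 ∂Measure.pi (fun _ : Fin n => ν)
      ≤ K ^ 2 / n := by
  have hn' : (n : ℝ) ≠ 0 := Nat.cast_ne_zero.2 hn
  set m := ∫ y, z y ∂ν
  have hL : MemLp z 2 ν := .of_bound hz.aestronglyMeasurable K (.of_forall hK)
  have hcentered : ∫ y, (z y - m) ∂ν = 0 := by
    rw [integral_sub (hL.integrable one_le_two) (integrable_const m), integral_const]
    simp [m]
  have hvar : ∫ y, ‖z y - m‖ ^ 2 ∂ν ≤ K ^ 2 := by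
    rw [integral_norm_sub_integral_sq hL]
    have hsq : ‖∫ y, ‖z y‖ ^ 2 ∂ν‖ ≤ K ^ 2 := norm_integral_le_of_forall_norm_le fun y => by
      rw [norm_pow, norm_norm]
      exact pow_le_pow_left₀ (norm_nonneg _) (hK y) 2
    linarith [le_abs_self (∫ y, ‖z y‖ ^ 2 ∂ν), Real.norm_eq_abs (∫ y, ‖z y‖ ^ 2 ∂ν),
      sq_nonneg ‖m‖]
  have hsum : ∀ x : Fin n → X, ‖sampleMean (fun j => z (x j)) - m‖ ^ 2
      = ((n : ℝ)⁻¹) ^ 2 * ‖∑ j, (z (x j) - m)‖ ^ 2 := fun x => by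
    rw [← mul_pow, ← Real.norm_natCast, ← norm_inv, ← norm_smul, Finset.sum_sub_distrib, smul_sub]
    simp [sampleMean, ← Nat.cast_smul_eq_nsmul ℝ, inv_smul_smul₀ hn']
  calc ∫ x, ‖sampleMean (fun j => z (x j)) - m‖ ^ 2 ∂Measure.pi (fun _ : Fin n => ν)
      = ((n : ℝ)⁻¹) ^ 2 * ∑ _j : Fin n, ∫ y, ‖z y - m‖ ^ 2 ∂ν := by
        simp only [hsum, integral_const_mul]
        rw [integral_norm_sum_sq_pi (fun _ : Fin n => ν) (z := fun _ y => z y - m)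
          (fun _ => hL.sub (memLp_const m)) fun _ => hcentered]
    _ = (∫ y, ‖z y - m‖ ^ 2 ∂ν) / n := by
        rw [Finset.sum_const, Finset.card_univ, Fintype.card_fin, nsmul_eq_mul]
        field_simp
    _ ≤ K ^ 2 / n := by gcongr

theorem integral_norm_sampleMean_sub_le (hz : StronglyMeasurable z) (hK : ∀ x, ‖z x‖ ≤ K)
    (hn : n ≠ 0) :
    ∫ x, ‖sampleMean (fun j => z (x j)) - ∫ y, z y ∂ν‖ ∂Measure.pi (fun _ : Fin n => ν)
      ≤ K / √n := by
  have hK0 : 0 ≤ K := (norm_nonneg _).trans (hK ν.nonempty_of_neZero.some)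
  have hbound : ∀ x : Fin n → X, ‖sampleMean (fun j => z (x j)) - ∫ y, z y ∂ν‖ ≤ K + K := fun x =>
    (norm_sub_le _ _).trans
      (add_le_add (norm_sampleMean_le hK0 fun j => hK (x j))
        (norm_integral_le_of_forall_norm_le hK))
  have hL : MemLp (fun x : Fin n → X => ‖sampleMean (fun j => z (x j)) - ∫ y, z y ∂ν‖) 2
      (Measure.pi fun _ => ν) :=
    .of_bound (measurable_norm_sampleMean_sub hz _).aestronglyMeasurable (K + K) <|
      .of_forall fun x => by simpa using hbound x
  refine (abs_le_of_sq_le_sq' ?_ (by positivity)).2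
  rw [div_pow, Real.sq_sqrt n.cast_nonneg]
  refine le_trans ?_ (integral_norm_sampleMean_sub_sq_le ν hz hK hn)
  simpa [variance_eq_sub hL] using variance_nonneg
    (fun x : Fin n → X => ‖sampleMean (fun j => z (x j)) - ∫ y, z y ∂ν‖) (Measure.pi fun _ => ν)

theorem measureReal_norm_sampleMean_sub_ge_le (hz : StronglyMeasurable z) (hK : ∀ x, ‖z x‖ ≤ K)
    (hn : n ≠ 0) {s : ℝ} (hs : 0 ≤ s) :
    (Measure.pi fun _ : Fin n => ν).real
        {x | K / √n + s ≤ ‖sampleMean (fun j => z (x j)) - ∫ y, z y ∂ν‖}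
      ≤ Real.exp (-(n * s ^ 2) / (2 * K ^ 2)) := by
  have hK0 : 0 ≤ K := (norm_nonneg _).trans (hK ν.nonempty_of_neZero.some)
  lift K to ℝ≥0 using hK0
  have hsubG := hasSubgaussianMGF_pi_of_boundedDifferences (fun _ : Fin n => ν)
    (measurable_norm_sampleMean_sub hz (∫ y, z y ∂ν)) (c := fun _ => 2 * K / n) fun x i y => by
      simpa using abs_norm_sampleMean_update_sub_sub_le hK (∫ y, z y ∂ν) x i y
  have hmean := integral_norm_sampleMean_sub_le ν hz hK hn
  refine (measureReal_mono fun x hx => ?_).trans ((hsubG.measure_ge_le hs).trans_eq ?_)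
  · rw [Set.mem_ofPred_eq] at hx ⊢
    linarith
  · congr 1
    simp only [Finset.sum_const, Finset.card_univ, Fintype.card_fin, nsmul_eq_mul]
    push_cast
    field_simp

end IdenticallyDistributed

theorem measureReal_norm_sampleMean_sub_sampleMean_sub_ge_le {X₁ X₂ : Type*} [MeasurableSpace X₁]
    [MeasurableSpace X₂] (ν₁ : Measure X₁) [IsProbabilityMeasure ν₁] (ν₂ : Measure X₂)
    [IsProbabilityMeasure ν₂] {z₁ : X₁ → H} {z₂ : X₂ → H} {K : ℝ}
    (hz₁ : StronglyMeasurable z₁) (hK₁ : ∀ x, ‖z₁ x‖ ≤ K)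
    (hz₂ : StronglyMeasurable z₂) (hK₂ : ∀ x, ‖z₂ x‖ ≤ K) {n : ℕ} (hn : n ≠ 0) {s : ℝ}
    (hs : 0 ≤ s) :
    ((Measure.pi fun _ : Fin n => ν₁).prod (Measure.pi fun _ : Fin n => ν₂)).real
        {x | 2 * (K / √n + s) ≤ ‖(sampleMean (fun j => z₁ (x.1 j))
          - sampleMean (fun j => z₂ (x.2 j))) - (∫ y, z₁ y ∂ν₁ - ∫ y, z₂ y ∂ν₂)‖}
      ≤ 2 * Real.exp (-(n * s ^ 2) / (2 * K ^ 2)) := by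
  set d₁ : (Fin n → X₁) → ℝ := fun x => ‖sampleMean (fun j => z₁ (x j)) - ∫ y, z₁ y ∂ν₁‖
  set d₂ : (Fin n → X₂) → ℝ := fun x => ‖sampleMean (fun j => z₂ (x j)) - ∫ y, z₂ y ∂ν₂‖
  set A₁ := {x | K / √n + s ≤ d₁ x}
  set A₂ := {x | K / √n + s ≤ d₂ x}
  calc _ ≤ ((Measure.pi fun _ : Fin n => ν₁).prod (Measure.pi fun _ : Fin n => ν₂)).real
        (A₁ ×ˢ Set.univ ∪ Set.univ ×ˢ A₂) := measureReal_mono fun x hx => by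
          rw [Set.mem_ofPred_eq, sub_sub_sub_comm] at hx
          have htri := hx.trans (norm_sub_le _ _)
          by_contra hout
          simp only [Set.mem_union, Set.mem_prod, Set.mem_univ, and_true, true_and, not_or,
            A₁, A₂, Set.mem_ofPred_eq, not_le] at hout
          linarith [hout.1, hout.2]
    _ ≤ (Measure.pi fun _ : Fin n => ν₁).real A₁ + (Measure.pi fun _ : Fin n => ν₂).real A₂ := by
        refine (measureReal_union_le _ _).trans_eq ?_
        rw [measureReal_prod_prod, measureReal_prod_prod, probReal_univ, probReal_univ, mul_one,
          one_mul]
    _ ≤ _ := by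
        linarith [measureReal_norm_sampleMean_sub_ge_le ν₁ hz₁ hK₁ hn hs,
          measureReal_norm_sampleMean_sub_ge_le ν₂ hz₂ hK₂ hn hs]

end HilbertConcentration

section SqrtChernoff

variable {X : Type*} [MeasurableSpace X] (ν : Measure X) [IsProbabilityMeasure ν] {Y : X → ℝ}
  {b : ℝ}

theorem mgf_le_of_forall_mem_Icc (hY : Measurable Y) (hYb : ∀ x, Y x ∈ Set.Icc 0 b) {l : ℝ}
    (hl : |l| * b ≤ 1) : mgf Y ν l ≤ Real.exp ((∫ x, Y x ∂ν) * (l + b * l ^ 2)) := by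
  have exp_le (x : X) : Real.exp (l * Y x) ≤ 1 + Y x * (l + b * l ^ 2) := by
    obtain ⟨hY0, hY1⟩ := hYb x
    have hlY : |l * Y x| ≤ 1 := by
      rw [abs_mul, abs_of_nonneg hY0]
      exact (mul_le_mul_of_nonneg_left hY1 (abs_nonneg l)).trans hl
    have hsq : Y x ^ 2 ≤ Y x * b := by rw [sq]; exact mul_le_mul_of_nonneg_left hY1 hY0
    nlinarith [(abs_le.1 (Real.abs_exp_sub_one_sub_id_le hlY)).2, sq_nonneg l]
  have hYi : Integrable (fun x => Y x * (l + b * l ^ 2)) ν :=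
    (Integrable.of_mem_Icc 0 b hY.aemeasurable (.of_forall hYb)).mul_const _
  calc mgf Y ν l ≤ ∫ x, (1 + Y x * (l + b * l ^ 2)) ∂ν :=
        integral_mono (integrable_exp_mul_of_mem_Icc hY.aemeasurable (.of_forall hYb))
          ((integrable_const _).add hYi) exp_le
    _ = (∫ x, Y x ∂ν) * (l + b * l ^ 2) + 1 := by
        rw [integral_add (integrable_const _) hYi, integral_mul_const, integral_const,
          probReal_univ, one_smul, add_comm]
    _ ≤ _ := Real.add_one_le_exp _

variable {D : ℕ} {s : ℝ}

theorem mgf_sum_pi_le_of_forall_mem_Icc (hY : Measurable Y) (hYb : ∀ x, Y x ∈ Set.Icc 0 b)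
    {l : ℝ} (hl : |l| * b ≤ 1) :
    mgf (fun x => ∑ i, Y (x i)) (Measure.pi fun _ : Fin D => ν) l
      ≤ Real.exp (D * ((∫ x, Y x ∂ν) * (l + b * l ^ 2))) := by
  simp only [mgf, Finset.mul_sum, Real.exp_sum]
  rw [integral_fintype_prod_eq_pow (fun x => Real.exp (l * Y x)), Fintype.card_fin,
    Real.exp_nat_mul]
  exact pow_le_pow_left₀ mgf_nonneg (mgf_le_of_forall_mem_Icc ν hY hYb hl) D

theorem integrable_exp_mul_sum_pi (hY : Measurable Y) (hYb : ∀ x, Y x ∈ Set.Icc 0 b) (l : ℝ) :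
    Integrable (fun x : Fin D → X => Real.exp (l * ∑ i, Y (x i))) (Measure.pi fun _ => ν) := by
  simp only [Finset.mul_sum, Real.exp_sum]
  exact Integrable.fintype_prod fun _ =>
    integrable_exp_mul_of_mem_Icc hY.aemeasurable (.of_forall hYb)

theorem measureReal_sum_ge_sq_sqrt_add_le (hY : Measurable Y) (hYb : ∀ x, Y x ∈ Set.Icc 0 b)
    (hb : 0 < b) (hs : 0 < s) :
    (Measure.pi fun _ : Fin D => ν).real {x | D * (√(∫ x, Y x ∂ν) + s) ^ 2 ≤ ∑ i, Y (x i)}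
      ≤ Real.exp (-(D * s ^ 2 / (4 * b))) := by
  set r := √(∫ x, Y x ∂ν)
  have hr : 0 ≤ r := Real.sqrt_nonneg _
  have mean_eq : ∫ x, Y x ∂ν = r ^ 2 := (Real.sq_sqrt (integral_nonneg fun x => (hYb x).1)).symm
  -- `s / (b * r)` is asymptotically optimal as `s → 0`; `r + s` in place of `r` keeps `l * b ≤ 1`.
  set l := s / (b * (r + s)) with hl_def
  have hl : 0 ≤ l := by positivity
  have hlb : |l| * b ≤ 1 := by
    rw [abs_of_nonneg hl, hl_def, div_mul_eq_mul_div, div_le_one (by positivity)]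
    nlinarith
  have exponent_eq : -l * (D * (r + s) ^ 2) + D * (r ^ 2 * (l + b * l ^ 2))
      = -(D * s ^ 2 / (4 * b)) - (D * s ^ 2 / b * (3 / 4 + r * s / (r + s) ^ 2)) := by
    rw [hl_def]
    field_simp
    ring
  have mgf_le := mgf_sum_pi_le_of_forall_mem_Icc (D := D) ν hY hYb hlb
  refine (measure_ge_le_exp_mul_mgf _ hl (integrable_exp_mul_sum_pi ν hY hYb l)).trans
    ((mul_le_mul_of_nonneg_left mgf_le (Real.exp_nonneg _)).trans ?_)
  rw [mean_eq, ← Real.exp_add, Real.exp_le_exp, exponent_eq, sub_le_self_iff]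
  positivity

theorem measureReal_sum_le_sq_sqrt_sub_le (hY : Measurable Y) (hYb : ∀ x, Y x ∈ Set.Icc 0 b)
    (hb : 0 < b) (hs : 0 < s) (hsr : s ≤ √(∫ x, Y x ∂ν)) :
    (Measure.pi fun _ : Fin D => ν).real {x | ∑ i, Y (x i) ≤ D * (√(∫ x, Y x ∂ν) - s) ^ 2}
      ≤ Real.exp (-(D * s ^ 2 / (4 * b))) := by
  set r := √(∫ x, Y x ∂ν)
  have hr : 0 < r := hs.trans_le hsr
  have mean_eq : ∫ x, Y x ∂ν = r ^ 2 := (Real.sq_sqrt (integral_nonneg fun x => (hYb x).1)).symm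
  -- The optimal exponent in the extreme case `s = r`, scaled linearly in `s`.
  set l := -(s / (2 * r * b)) with hl_def
  have hl : l ≤ 0 := neg_nonpos.2 (by positivity)
  have hlb : |l| * b ≤ 1 := by
    rw [abs_of_nonpos hl, hl_def, neg_neg, div_mul_eq_mul_div, div_le_one (by positivity)]
    nlinarith
  have exponent_eq : -l * (D * (r - s) ^ 2) + D * (r ^ 2 * (l + b * l ^ 2))
      = -(D * s ^ 2 / (4 * b)) - D * s ^ 2 * (r - s) / (2 * r * b) := by
    rw [hl_def]
    field_simp
    ring
  have mgf_le := mgf_sum_pi_le_of_forall_mem_Icc (D := D) ν hY hYb hlb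
  refine (measure_le_le_exp_mul_mgf _ hl (integrable_exp_mul_sum_pi ν hY hYb l)).trans
    ((mul_le_mul_of_nonneg_left mgf_le (Real.exp_nonneg _)).trans ?_)
  rw [mean_eq, ← Real.exp_add, Real.exp_le_exp, exponent_eq, sub_le_self_iff]
  exact div_nonneg (mul_nonneg (by positivity) (sub_nonneg.2 hsr)) (by positivity)

theorem measureReal_abs_sqrt_mean_sub_sqrt_integral_ge_le (hY : Measurable Y)
    (hYb : ∀ x, Y x ∈ Set.Icc 0 b) (hb : 0 < b) (hD : D ≠ 0) (hs : 0 < s) :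
    (Measure.pi fun _ : Fin D => ν).real
        {x | s ≤ |√((D : ℝ)⁻¹ * ∑ i, Y (x i)) - √(∫ x, Y x ∂ν)|}
      ≤ 2 * Real.exp (-(D * s ^ 2 / (4 * b))) := by
  set r := √(∫ x, Y x ∂ν)
  have sum_eq (x : Fin D → X) : ∑ i, Y (x i) = D * √((D : ℝ)⁻¹ * ∑ i, Y (x i)) ^ 2 := by
    rw [Real.sq_sqrt (mul_nonneg (by positivity) (Finset.sum_nonneg fun i _ => (hYb _).1))]
    field_simp
  have upper : {x : Fin D → X | s ≤ √((D : ℝ)⁻¹ * ∑ i, Y (x i)) - r}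
      ⊆ {x | D * (r + s) ^ 2 ≤ ∑ i, Y (x i)} := fun x (hx : s ≤ _) => by
    rw [Set.mem_ofPred_eq, sum_eq]
    have : 0 ≤ r := Real.sqrt_nonneg _
    gcongr
    linarith
  have lower : (Measure.pi fun _ : Fin D => ν).real
      {x | s ≤ r - √((D : ℝ)⁻¹ * ∑ i, Y (x i))} ≤ Real.exp (-(D * s ^ 2 / (4 * b))) := by
    rcases le_or_gt s r with hsr | hsr
    · refine (measureReal_mono fun x (hx : s ≤ _) => ?_).trans
        (measureReal_sum_le_sq_sqrt_sub_le ν hY hYb hb hs hsr)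
      rw [Set.mem_ofPred_eq, sum_eq]
      gcongr
      linarith
    · refine (measureReal_mono (s₂ := ∅) fun x (hx : s ≤ _) => ?_).trans (by simp [Real.exp_nonneg])
      linarith [Real.sqrt_nonneg ((D : ℝ)⁻¹ * ∑ i, Y (x i))]
  calc _ ≤ (Measure.pi fun _ : Fin D => ν).real
          ({x | s ≤ √((D : ℝ)⁻¹ * ∑ i, Y (x i)) - r}
            ∪ {x | s ≤ r - √((D : ℝ)⁻¹ * ∑ i, Y (x i))}) :=
        measureReal_mono fun x (hx : s ≤ _) => by simpa [le_abs, neg_sub] using hx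
    _ ≤ Real.exp (-(D * s ^ 2 / (4 * b))) + Real.exp (-(D * s ^ 2 / (4 * b))) :=
        (measureReal_union_le _ _).trans (add_le_add
          ((measureReal_mono upper).trans (measureReal_sum_ge_sq_sqrt_add_le ν hY hYb hb hs)) lower)
    _ = _ := (two_mul _).symm

end SqrtChernoff

section DiscountedSum

variable {V : Type*} [NormedAddCommGroup V] [NormedSpace ℝ V] {γ K : ℝ} {v : ℕ → V}

/-- The normalized discounted sum `(1 - γ) ∑_{t ≥ 0} γᵗ vₜ`, which turns a sequence of rewards or
features along a trajectory into its discounted average. -/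
noncomputable def discountedSum (γ : ℝ) (v : ℕ → V) : V :=
  (1 - γ) • ∑' t, γ ^ t • v t

/-- The truncation `(1 - γ) ∑_{t < T} γᵗ vₜ` of the normalized discounted sum to a horizon `T`. The
factor `1 - γ` is kept, so the weights no longer add up to `1`. -/
noncomputable def truncDiscountedSum (γ : ℝ) (T : ℕ) (v : ℕ → V) : V :=
  (1 - γ) • ∑ t ∈ Finset.range T, γ ^ t • v t

theorem norm_pow_smul_le (hγ : 0 ≤ γ) (hv : ∀ t, ‖v t‖ ≤ K) (t : ℕ) :
    ‖γ ^ t • v t‖ ≤ γ ^ t * K := by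
  rw [norm_smul, Real.norm_of_nonneg (pow_nonneg hγ t)]
  exact mul_le_mul_of_nonneg_left (hv t) (pow_nonneg hγ t)

theorem norm_discountedSum_le (hγ : 0 ≤ γ) (hγ' : γ < 1) (hv : ∀ t, ‖v t‖ ≤ K) :
    ‖discountedSum γ v‖ ≤ K := by
  have hγ₁ : 0 < 1 - γ := sub_pos.2 hγ'
  calc ‖discountedSum γ v‖ = (1 - γ) * ‖∑' t, γ ^ t • v t‖ := by
        rw [discountedSum, norm_smul, Real.norm_of_nonneg hγ₁.le]
    _ ≤ (1 - γ) * ((1 - γ)⁻¹ * K) := by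
        gcongr
        exact tsum_of_norm_bounded ((hasSum_geometric_of_lt_one hγ hγ').mul_right K)
          (norm_pow_smul_le hγ hv)
    _ = K := mul_inv_cancel_left₀ hγ₁.ne' K

theorem stronglyMeasurable_truncDiscountedSum {Z : Type*} [MeasurableSpace Z] {F : Z → ℕ → V}
    (hF : ∀ t, StronglyMeasurable fun z => F z t) (T : ℕ) :
    StronglyMeasurable fun z => truncDiscountedSum γ T (F z) :=
  (Finset.stronglyMeasurable_fun_sum _ fun t _ => (hF t).const_smul (γ ^ t)).const_smul _

variable [CompleteSpace V]

theorem summable_pow_smul (hγ : 0 ≤ γ) (hγ' : γ < 1) (hv : ∀ t, ‖v t‖ ≤ K) :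
    Summable fun t => γ ^ t • v t :=
  .of_norm_bounded ((summable_geometric_of_lt_one hγ hγ').mul_right K) (norm_pow_smul_le hγ hv)

theorem discountedSum_sub_truncDiscountedSum (hγ : 0 ≤ γ) (hγ' : γ < 1) (hv : ∀ t, ‖v t‖ ≤ K)
    (T : ℕ) :
    discountedSum γ v - truncDiscountedSum γ T v
      = γ ^ T • discountedSum γ fun t => v (t + T) := by
  rw [discountedSum, truncDiscountedSum, ← smul_sub,
    ← (summable_pow_smul hγ hγ' hv).sum_add_tsum_nat_add T, add_sub_cancel_left, discountedSum,
    smul_comm, ← tsum_const_smul'' (γ ^ T)]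
  simp only [smul_smul, pow_add, mul_comm]

theorem norm_discountedSum_sub_truncDiscountedSum_le (hγ : 0 ≤ γ) (hγ' : γ < 1)
    (hv : ∀ t, ‖v t‖ ≤ K) (T : ℕ) :
    ‖discountedSum γ v - truncDiscountedSum γ T v‖ ≤ γ ^ T * K := by
  rw [discountedSum_sub_truncDiscountedSum hγ hγ' hv, norm_smul,
    Real.norm_of_nonneg (pow_nonneg hγ T)]
  exact mul_le_mul_of_nonneg_left (norm_discountedSum_le hγ hγ' fun t => hv (t + T))
    (pow_nonneg hγ T)

theorem tendsto_truncDiscountedSum (hγ : 0 ≤ γ) (hγ' : γ < 1) (hv : ∀ t, ‖v t‖ ≤ K) :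
    Filter.Tendsto (fun T => truncDiscountedSum γ T v) Filter.atTop (nhds (discountedSum γ v)) :=
  (summable_pow_smul hγ hγ' hv).hasSum.tendsto_sum_nat.const_smul _

theorem stronglyMeasurable_discountedSum {Z : Type*} [MeasurableSpace Z] {F : Z → ℕ → V}
    (hγ : 0 ≤ γ) (hγ' : γ < 1) (hF : ∀ t, StronglyMeasurable fun z => F z t)
    (hK : ∀ z t, ‖F z t‖ ≤ K) : StronglyMeasurable fun z => discountedSum γ (F z) :=
  stronglyMeasurable_of_tendsto Filter.atTop (stronglyMeasurable_truncDiscountedSum hF)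
    (tendsto_pi_nhds.2 fun z => tendsto_truncDiscountedSum hγ hγ' (hK z))

end DiscountedSum

section DiscountedOccupancy

variable {X : Type*} [MeasurableSpace X] {γ : ℝ} (ν : Measure (ℕ → X)) [IsProbabilityMeasure ν]

/-- The discounted occupancy measure `(1 - γ) ∑ₜ γᵗ Pr(τₜ ∈ ·)` of a random trajectory `τ` with law
`ν`. -/
noncomputable def discountedOccupancy (γ : ℝ) (ν : Measure (ℕ → X)) : Measure X :=
  Measure.sum fun t : ℕ => ENNReal.ofReal ((1 - γ) * γ ^ t) • ν.map fun τ => τ t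

theorem isProbabilityMeasure_discountedOccupancy (hγ : 0 ≤ γ) (hγ' : γ < 1) :
    IsProbabilityMeasure (discountedOccupancy γ ν) := by
  have hγ₁ : 0 < 1 - γ := sub_pos.2 hγ'
  have map_univ (t : ℕ) : ν.map (fun τ => τ t) Set.univ = 1 := by
    rw [Measure.map_apply (measurable_pi_apply t) .univ, Set.preimage_univ, measure_univ]
  refine ⟨?_⟩
  rw [discountedOccupancy, Measure.sum_apply _ .univ]
  simp only [Measure.smul_apply, map_univ, smul_eq_mul, mul_one]
  rw [← ENNReal.ofReal_tsum_of_nonneg (fun t => mul_nonneg hγ₁.le (pow_nonneg hγ t))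
    ((summable_geometric_of_lt_one hγ hγ').mul_left _), tsum_mul_left,
    tsum_geometric_of_lt_one hγ hγ', mul_inv_cancel₀ hγ₁.ne', ENNReal.ofReal_one]

variable {V : Type*} [NormedAddCommGroup V] [NormedSpace ℝ V] {f : X → V} {K : ℝ}

theorem integral_discountedSum (hγ : 0 ≤ γ) (hγ' : γ < 1) (hf : StronglyMeasurable f)
    (hK : ∀ x, ‖f x‖ ≤ K) :
    ∫ τ, discountedSum γ (fun t => f (τ t)) ∂ν = discountedSum γ fun t => ∫ τ, f (τ t) ∂ν := by
  have hfi (t : ℕ) : Integrable (fun τ : ℕ → X => γ ^ t • f (τ t)) ν :=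
    (Integrable.of_bound (hf.comp_measurable (measurable_pi_apply t)).aestronglyMeasurable K
      (.of_forall fun τ => hK _)).smul _
  have hsum : Summable fun t => ∫ τ, ‖γ ^ t • f (τ t)‖ ∂ν := by
    refine .of_nonneg_of_le (fun t => integral_nonneg fun τ => norm_nonneg _) (fun t => ?_)
      ((summable_geometric_of_lt_one hγ hγ').mul_right K)
    refine (integral_mono (hfi t).norm (integrable_const _)
      fun τ => norm_pow_smul_le hγ (fun t => hK (τ t)) t).trans_eq ?_
    rw [integral_const, probReal_univ, one_smul]
  simp only [discountedSum, integral_smul, ← integral_tsum_of_summable_integral_norm hfi hsum]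

theorem integral_discountedOccupancy (hγ : 0 ≤ γ) (hγ' : γ < 1) (hf : StronglyMeasurable f)
    (hK : ∀ x, ‖f x‖ ≤ K) :
    ∫ x, f x ∂(discountedOccupancy γ ν) = ∫ τ, discountedSum γ (fun t => f (τ t)) ∂ν := by
  have := isProbabilityMeasure_discountedOccupancy ν hγ hγ'
  have hfi : Integrable f (discountedOccupancy γ ν) :=
    .of_bound hf.aestronglyMeasurable K (.of_forall hK)
  rw [integral_discountedSum ν hγ hγ' hf hK, discountedSum, ← tsum_const_smul'',
    discountedOccupancy, integral_sum_measure hfi]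
  refine tsum_congr fun t => ?_
  rw [integral_smul_measure, integral_map (measurable_pi_apply t).aemeasurable
    hf.aestronglyMeasurable, ENNReal.toReal_ofReal
    (mul_nonneg (sub_nonneg.2 hγ'.le) (pow_nonneg hγ t)), smul_smul]

end DiscountedOccupancy

section RandomFeatures

variable {X Θ : Type*} [MeasurableSpace X] {c : Θ → X → ℝ} {K : ℝ}

/-- The difference of the means of the random feature `c θ` under `P` and `Q`. -/
noncomputable def featureGap (c : Θ → X → ℝ) (P Q : Measure X) (θ : Θ) : ℝ :=
  (∫ x, c θ x ∂P) - ∫ x, c θ x ∂Q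

variable (P Q : Measure X) [IsProbabilityMeasure P] [IsProbabilityMeasure Q]

theorem abs_integral_feature_le (hK : ∀ θ x, |c θ x| ≤ K) (θ : Θ) : |∫ x, c θ x ∂P| ≤ K :=
  norm_integral_le_of_forall_norm_le (f := c θ) (μ := P) (K := K) (hK θ)

theorem featureGap_sq_mem_Icc (hK : ∀ θ x, |c θ x| ≤ K) (θ : Θ) :
    featureGap c P Q θ ^ 2 ∈ Set.Icc 0 (4 * K ^ 2) := by
  refine ⟨sq_nonneg _, ?_⟩
  have h : |featureGap c P Q θ| ≤ 2 * K := (abs_sub _ _).trans <| by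
    linarith [abs_integral_feature_le P hK θ, abs_integral_feature_le Q hK θ]
  calc featureGap c P Q θ ^ 2 ≤ (2 * K) ^ 2 := sq_le_sq' (abs_le.1 h).1 (abs_le.1 h).2
    _ = 4 * K ^ 2 := by ring

variable [MeasurableSpace Θ]

theorem measurable_integral_feature (hc : Measurable (Function.uncurry c)) :
    Measurable fun θ => ∫ x, c θ x ∂P :=
  hc.stronglyMeasurable.integral_prod_right.measurable

theorem measurable_featureGap (hc : Measurable (Function.uncurry c)) :
    Measurable (featureGap c P Q) :=
  (measurable_integral_feature P hc).sub (measurable_integral_feature Q hc)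

variable (Λ : Measure Θ) [IsProbabilityMeasure Λ]

theorem integrable_integral_feature_mul_integral_feature (hc : Measurable (Function.uncurry c))
    (hK : ∀ θ x, |c θ x| ≤ K) :
    Integrable (fun θ => (∫ x, c θ x ∂P) * ∫ x, c θ x ∂Q) Λ := by
  refine .of_bound ((measurable_integral_feature P hc).mul
    (measurable_integral_feature Q hc)).aestronglyMeasurable (K * K) (.of_forall fun θ => ?_)
  have hP := abs_integral_feature_le P hK θ
  rw [norm_mul]
  exact mul_le_mul hP (abs_integral_feature_le Q hK θ) (abs_nonneg _) ((abs_nonneg _).trans hP)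

variable {H : Type*} [NormedAddCommGroup H] [InnerProductSpace ℝ H] [CompleteSpace H] {Φ : X → H}

theorem inner_integral_integral_eq_integral_feature_mul
    (hΦ : ∀ x y, inner ℝ (Φ x) (Φ y) = ∫ θ, c θ x * c θ y ∂Λ) (hΦP : Integrable Φ P)
    (hΦQ : Integrable Φ Q) (hc : Measurable (Function.uncurry c)) (hK : ∀ θ x, |c θ x| ≤ K) :
    inner ℝ (∫ x, Φ x ∂P) (∫ x, Φ x ∂Q) = ∫ θ, (∫ x, c θ x ∂P) * ∫ x, c θ x ∂Q ∂Λ := by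
  have hint : Integrable (Function.uncurry fun (z : X × X) θ => c θ z.1 * c θ z.2)
      ((P.prod Q).prod Λ) := by
    have hmeas (f : X × X → X) (hf : Measurable f) :
        Measurable fun y : (X × X) × Θ => c y.2 (f y.1) :=
      hc.comp (measurable_snd.prodMk (hf.comp measurable_fst))
    refine .of_bound ((hmeas _ measurable_fst).mul
      (hmeas _ measurable_snd)).aestronglyMeasurable (K * K) (.of_forall fun ⟨z, θ⟩ => ?_)
    rw [Function.uncurry_apply_pair, norm_mul]
    exact mul_le_mul (hK θ z.1) (hK θ z.2) (abs_nonneg _) ((abs_nonneg _).trans (hK θ z.1))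
  calc inner ℝ (∫ x, Φ x ∂P) (∫ x, Φ x ∂Q)
      = ∫ z, inner ℝ (Φ z.1) (Φ z.2) ∂(P.prod Q) :=
        (integral_prod_bilin (innerSL ℝ) hΦP hΦQ).symm
    _ = ∫ θ, ∫ z : X × X, c θ z.1 * c θ z.2 ∂(P.prod Q) ∂Λ := by
        simp only [hΦ]
        exact integral_integral_swap hint
    _ = ∫ θ, (∫ x, c θ x ∂P) * ∫ x, c θ x ∂Q ∂Λ := by simp only [integral_prod_mul]

theorem norm_integral_sub_integral_sq_eq_integral_featureGap_sq
    (hΦ : ∀ x y, inner ℝ (Φ x) (Φ y) = ∫ θ, c θ x * c θ y ∂Λ) (hΦP : Integrable Φ P)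
    (hΦQ : Integrable Φ Q) (hc : Measurable (Function.uncurry c)) (hK : ∀ θ x, |c θ x| ≤ K) :
    ‖(∫ x, Φ x ∂P) - ∫ x, Φ x ∂Q‖ ^ 2 = ∫ θ, featureGap c P Q θ ^ 2 ∂Λ := by
  have hPP := integrable_integral_feature_mul_integral_feature P P Λ hc hK
  have hPQ := (integrable_integral_feature_mul_integral_feature P Q Λ hc hK).const_mul 2
  have hQQ := integrable_integral_feature_mul_integral_feature Q Q Λ hc hK
  have hdiff := hPP.sub hPQ
  simp only [Pi.sub_def] at hdiff
  rw [norm_sub_sq_real, ← real_inner_self_eq_norm_sq, ← real_inner_self_eq_norm_sq,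
    inner_integral_integral_eq_integral_feature_mul P P Λ hΦ hΦP hΦP hc hK,
    inner_integral_integral_eq_integral_feature_mul P Q Λ hΦ hΦP hΦQ hc hK,
    inner_integral_integral_eq_integral_feature_mul Q Q Λ hΦ hΦQ hΦQ hc hK,
    ← integral_const_mul, ← integral_sub hPP hPQ, ← integral_add hdiff hQQ]
  refine integral_congr_ae (.of_forall fun θ => ?_)
  simp only [featureGap]
  ring

end RandomFeatures

section FourierFeatures

variable {d : ℕ}

instance isProbabilityMeasure_uniform_phase :
    IsProbabilityMeasure (cond (volume : Measure ℝ) (Set.Icc 0 (2 * Real.pi))) :=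
  cond_isProbabilityMeasure_of_finite (by simp [Real.pi_pos])
    (by rw [Real.volume_Icc]; exact ENNReal.ofReal_ne_top)

instance isProbabilityMeasure_featureLaw (σ : ℝ) : IsProbabilityMeasure (featureLaw d σ) := by
  unfold featureLaw
  infer_instance

/-- The normalized random Fourier feature `√2 cos(⟨w, x⟩ + b)` with parameter `θ = (w, b)`, so that
`fourierFeature` consists of `D` such features divided by `√D`. -/
noncomputable def cosFeature (θ : EuclideanSpace ℝ (Fin d) × ℝ) (x : EuclideanSpace ℝ (Fin d)) :
    ℝ :=
  √2 * Real.cos (inner ℝ θ.1 x + θ.2)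

theorem measurable_uncurry_cosFeature : Measurable (Function.uncurry (cosFeature (d := d))) := by
  unfold Function.uncurry cosFeature
  fun_prop

theorem abs_cosFeature_le (θ : EuclideanSpace ℝ (Fin d) × ℝ) (x : EuclideanSpace ℝ (Fin d)) :
    |cosFeature θ x| ≤ √2 := by
  rw [cosFeature, abs_mul, abs_of_nonneg (Real.sqrt_nonneg 2)]
  exact mul_le_of_le_one_right (Real.sqrt_nonneg 2) (Real.abs_cos_le_one _)

theorem fourierFeature_apply {D : ℕ} (θ : Fin D → EuclideanSpace ℝ (Fin d) × ℝ)
    (x : EuclideanSpace ℝ (Fin d)) (i : Fin D) :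
    fourierFeature θ x i = (√D)⁻¹ * cosFeature (θ i) x := by
  simp only [fourierFeature, cosFeature]
  rw [Real.sqrt_div zero_le_two]
  ring

theorem norm_fourierFeature_le {D : ℕ} (θ : Fin D → EuclideanSpace ℝ (Fin d) × ℝ)
    (x : EuclideanSpace ℝ (Fin d)) : ‖fourierFeature θ x‖ ≤ √2 := by
  refine Real.le_sqrt_of_sq_le ?_
  have coord_sq_le (i : Fin D) : fourierFeature θ x i ^ 2 ≤ 2 / D := by
    simp only [fourierFeature, mul_pow]
    rw [Real.sq_sqrt (by positivity)]
    exact mul_le_of_le_one_right (by positivity) (Real.cos_sq_le_one _)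
  calc ‖fourierFeature θ x‖ ^ 2 = ∑ i, fourierFeature θ x i ^ 2 :=
        EuclideanSpace.real_norm_sq_eq _
    _ ≤ ∑ _i : Fin D, 2 / (D : ℝ) := Finset.sum_le_sum fun i _ => coord_sq_le i
    _ = D * (2 / D) := by rw [Finset.sum_const, Finset.card_fin, nsmul_eq_mul]
    _ ≤ 2 := by rw [mul_div_left_comm]; exact mul_le_of_le_one_right zero_le_two (div_self_le_one _)

theorem measurable_uncurry_fourierFeature {D : ℕ} :
    Measurable (Function.uncurry (fourierFeature (d := d) (D := D))) := by
  refine (WithLp.measurable_toLp 2 _).comp (measurable_pi_iff.2 fun i => ?_)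
  fun_prop

theorem stronglyMeasurable_fourierFeature {D : ℕ} (θ : Fin D → EuclideanSpace ℝ (Fin d) × ℝ) :
    StronglyMeasurable (fourierFeature θ) :=
  (measurable_uncurry_fourierFeature.of_uncurry_left (x := θ)).stronglyMeasurable

theorem integral_cos_inner_eq_re_charFun {E : Type*} [NormedAddCommGroup E]
    [InnerProductSpace ℝ E] [MeasurableSpace E] [OpensMeasurableSpace E] (μ : Measure E)
    [IsFiniteMeasure μ] (u : E) : ∫ w, Real.cos (inner ℝ w u) ∂μ = (charFun μ u).re := by
  have hint : Integrable (fun w => Complex.exp (((inner ℝ w u : ℝ) : ℂ) * Complex.I)) μ := by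
    refine .of_bound (Continuous.stronglyMeasurable ?_).aestronglyMeasurable 1
      (.of_forall fun w => ?_)
    · fun_prop
    · rw [Complex.norm_exp_ofReal_mul_I]
  rw [charFun_apply, ← RCLike.re_eq_complex_re, ← integral_re hint]
  simp only [RCLike.re_eq_complex_re, Complex.exp_ofReal_mul_I_re]

theorem integral_cos_inner_multivariateGaussian (σ : ℝ) (u : EuclideanSpace ℝ (Fin d)) :
    ∫ w, Real.cos (inner ℝ w u)
        ∂(multivariateGaussian 0 ((σ ^ 2)⁻¹ • (1 : Matrix (Fin d) (Fin d) ℝ)))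
      = Real.exp (-‖u‖ ^ 2 / (2 * σ ^ 2)) := by
  have covariance_apply :
      u.ofLp ⬝ᵥ ((σ ^ 2)⁻¹ • (1 : Matrix (Fin d) (Fin d) ℝ)).mulVec u.ofLp
        = (σ ^ 2)⁻¹ * ‖u‖ ^ 2 := by
    rw [Matrix.smul_mulVec, Matrix.one_mulVec, dotProduct_smul, EuclideanSpace.real_norm_sq_eq]
    simp only [dotProduct, sq, smul_eq_mul]
  have exponent_eq : ((0 : ℝ) : ℂ) * Complex.I - (((σ ^ 2)⁻¹ * ‖u‖ ^ 2 : ℝ) : ℂ) / 2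
      = ((-‖u‖ ^ 2 / (2 * σ ^ 2) : ℝ) : ℂ) := by
    push_cast
    ring
  rw [integral_cos_inner_eq_re_charFun,
    charFun_multivariateGaussian (Matrix.PosSemidef.one.smul (by positivity)), covariance_apply,
    inner_zero_right, exponent_eq, Complex.exp_ofReal_re]

theorem integral_cos_add_two_mul_uniform_phase (c : ℝ) :
    ∫ b, Real.cos (c + 2 * b) ∂(cond (volume : Measure ℝ) (Set.Icc 0 (2 * Real.pi))) = 0 := by
  have sin_periodic : Real.sin (c + 2 * (2 * Real.pi)) = Real.sin c := by
    simpa using Real.sin_add_nat_mul_two_pi c 2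
  rw [ProbabilityTheory.cond, integral_smul_measure, integral_Icc_eq_integral_Ioc,
    ← intervalIntegral.integral_of_le (by positivity),
    intervalIntegral.integral_comp_add_mul (fun x => Real.cos x) two_ne_zero, integral_cos,
    sin_periodic, mul_zero, add_zero, sub_self, smul_zero, smul_zero]

theorem cosFeature_mul_cosFeature (θ : EuclideanSpace ℝ (Fin d) × ℝ)
    (x y : EuclideanSpace ℝ (Fin d)) :
    cosFeature θ x * cosFeature θ y
      = Real.cos (inner ℝ θ.1 (x - y)) + Real.cos (inner ℝ θ.1 (x + y) + 2 * θ.2) := by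
  have hsub : inner ℝ θ.1 (x - y) = (inner ℝ θ.1 x + θ.2) - (inner ℝ θ.1 y + θ.2) := by
    rw [inner_sub_right]; ring
  have hadd : inner ℝ θ.1 (x + y) + 2 * θ.2
      = (inner ℝ θ.1 x + θ.2) + (inner ℝ θ.1 y + θ.2) := by
    rw [inner_add_right]; ring
  rw [hsub, hadd, Real.cos_sub (inner ℝ θ.1 x + θ.2), Real.cos_add (inner ℝ θ.1 x + θ.2),
    cosFeature, cosFeature, mul_mul_mul_comm, Real.mul_self_sqrt zero_le_two]
  ring

theorem gaussianKernel_eq_integral_cosFeature_mul (σ : ℝ) (x y : EuclideanSpace ℝ (Fin d)) :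
    gaussianKernel σ x y = ∫ θ, cosFeature θ x * cosFeature θ y ∂(featureLaw d σ) := by
  have hdiff : Integrable (fun θ : EuclideanSpace ℝ (Fin d) × ℝ => Real.cos (inner ℝ θ.1 (x - y)))
      (featureLaw d σ) :=
    .of_bound (by fun_prop) 1 (.of_forall fun θ => Real.abs_cos_le_one _)
  have hphase : Integrable (fun θ : EuclideanSpace ℝ (Fin d) × ℝ =>
      Real.cos (inner ℝ θ.1 (x + y) + 2 * θ.2)) (featureLaw d σ) :=
    .of_bound (by fun_prop) 1 (.of_forall fun θ => Real.abs_cos_le_one _)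
  simp only [cosFeature_mul_cosFeature]
  rw [integral_add hdiff hphase]
  unfold featureLaw at hdiff hphase ⊢
  rw [integral_prod _ hdiff, integral_prod _ hphase]
  simp only [integral_cos_add_two_mul_uniform_phase, integral_const, probReal_univ, one_smul,
    smul_zero, add_zero]
  exact (integral_cos_inner_multivariateGaussian σ (x - y)).symm

end FourierFeatures

section GaussianMMD

variable {d : ℕ} (σ : ℝ)

theorem norm_gaussianFeature (x : EuclideanSpace ℝ (Fin d)) : ‖gaussianFeature σ x‖ = 1 := by
  rw [← sq_eq_sq₀ (norm_nonneg _) zero_le_one, ← real_inner_self_eq_norm_sq,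
    inner_gaussianFeature, gaussianKernel]
  simp

theorem continuous_gaussianFeature : Continuous (gaussianFeature (d := d) σ) := by
  have norm_sub_eq (x y : EuclideanSpace ℝ (Fin d)) :
      ‖gaussianFeature σ y - gaussianFeature σ x‖ = √(2 - 2 * gaussianKernel σ y x) := by
    rw [← Real.sqrt_sq (norm_nonneg (gaussianFeature σ y - gaussianFeature σ x)),
      norm_sub_sq_real, norm_gaussianFeature, norm_gaussianFeature, inner_gaussianFeature]
    ring_nf
  refine continuous_iff_continuousAt.2 fun x => tendsto_iff_norm_sub_tendsto_zero.2 ?_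
  have hcont : Continuous fun y => √(2 - 2 * gaussianKernel σ y x) := by
    unfold gaussianKernel
    fun_prop
  simpa [norm_sub_eq, gaussianKernel] using hcont.tendsto x

variable (P Q : Measure (EuclideanSpace ℝ (Fin d))) [IsProbabilityMeasure P]
  [IsProbabilityMeasure Q]

theorem integrable_gaussianFeature : Integrable (gaussianFeature σ) P :=
  .of_bound (continuous_gaussianFeature σ).aestronglyMeasurable 1
    (.of_forall fun x => (norm_gaussianFeature σ x).le)

theorem norm_integral_gaussianFeature_le_one : ‖∫ x, gaussianFeature σ x ∂P‖ ≤ 1 :=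
  norm_integral_le_of_forall_norm_le (f := gaussianFeature σ) (K := 1)
    fun x => (norm_gaussianFeature σ x).le

theorem gaussianMMD_le_two : gaussianMMD σ P Q ≤ 2 :=
  (norm_sub_le _ _).trans <| by
    linarith [norm_integral_gaussianFeature_le_one σ P, norm_integral_gaussianFeature_le_one σ Q]

theorem gaussianMMD_eq_sqrt_integral :
    gaussianMMD σ P Q = √(∫ θ, featureGap cosFeature P Q θ ^ 2 ∂(featureLaw d σ)) := by
  have inner_eq (x y : EuclideanSpace ℝ (Fin d)) :
      inner ℝ (gaussianFeature σ x) (gaussianFeature σ y)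
        = ∫ θ, cosFeature θ x * cosFeature θ y ∂(featureLaw d σ) :=
    (inner_gaussianFeature σ x y).trans (gaussianKernel_eq_integral_cosFeature_mul σ x y)
  have hsq := norm_integral_sub_integral_sq_eq_integral_featureGap_sq P Q (featureLaw d σ) inner_eq
    (integrable_gaussianFeature σ P) (integrable_gaussianFeature σ Q)
    measurable_uncurry_cosFeature abs_cosFeature_le
  rw [gaussianMMD, ← hsq, Real.sqrt_sq (norm_nonneg _)]

variable {D : ℕ}

theorem integral_fourierFeature_apply (θ : Fin D → EuclideanSpace ℝ (Fin d) × ℝ) (i : Fin D) :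
    (∫ x, fourierFeature θ x ∂P) i = (√D)⁻¹ * ∫ x, cosFeature (θ i) x ∂P := by
  have hint : Integrable (fourierFeature θ) P :=
    .of_bound (stronglyMeasurable_fourierFeature θ).aestronglyMeasurable _
      (.of_forall (norm_fourierFeature_le θ))
  rw [← integral_const_mul]
  simp only [← fourierFeature_apply]
  exact ((EuclideanSpace.proj (𝕜 := ℝ) i).integral_comp_comm hint).symm

theorem norm_integral_fourierFeature_sub (θ : Fin D → EuclideanSpace ℝ (Fin d) × ℝ) :
    ‖(∫ x, fourierFeature θ x ∂P) - ∫ x, fourierFeature θ x ∂Q‖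
      = √((D : ℝ)⁻¹ * ∑ i, featureGap cosFeature P Q (θ i) ^ 2) := by
  rw [← Real.sqrt_sq (norm_nonneg (_ - _)), EuclideanSpace.real_norm_sq_eq]
  simp only [PiLp.sub_apply, integral_fourierFeature_apply, ← mul_sub, mul_pow, inv_pow,
    Real.sq_sqrt (Nat.cast_nonneg D), ← Finset.mul_sum, featureGap]

theorem measureReal_abs_norm_integral_fourierFeature_sub_sub_gaussianMMD_ge_le (hD : D ≠ 0) {s : ℝ}
    (hs : 0 < s) :
    (Measure.pi fun _ : Fin D => featureLaw d σ).real {θ | s ≤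
        |‖(∫ x, fourierFeature θ x ∂P) - ∫ x, fourierFeature θ x ∂Q‖ - gaussianMMD σ P Q|}
      ≤ 2 * Real.exp (-(D * s ^ 2 / 32)) := by
  have gap_sq_mem (θ : EuclideanSpace ℝ (Fin d) × ℝ) :
      featureGap cosFeature P Q θ ^ 2 ∈ Set.Icc (0 : ℝ) 8 := by
    have h := featureGap_sq_mem_Icc P Q abs_cosFeature_le θ
    rwa [Real.sq_sqrt zero_le_two, show (4 * 2 : ℝ) = 8 by norm_num] at h
  have h := measureReal_abs_sqrt_mean_sub_sqrt_integral_ge_le (featureLaw d σ)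
    ((measurable_featureGap P Q measurable_uncurry_cosFeature).pow_const 2) gap_sq_mem
    (by norm_num) hD hs
  simp only [norm_integral_fourierFeature_sub, gaussianMMD_eq_sqrt_integral]
  rwa [show (4 * 8 : ℝ) = 32 by norm_num] at h

end GaussianMMD

theorem abs_norm_sub_le_add_norm_sub {V : Type*} [SeminormedAddCommGroup V] (u v : V) (b : ℝ) :
    |‖u‖ - b| ≤ |‖v‖ - b| + ‖u - v‖ := by
  linarith [abs_sub_le ‖u‖ ‖v‖ b, abs_norm_sub_norm_le u v]

section PathFeatures

variable {X : Type*} {d D : ℕ}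

/-- The feature `(1 - γ) ∑_{t ≥ 0} γᵗ φ(g(τₜ))` of a trajectory `τ` in a space mapped to `ℝᵈ` by
`g`; with `g = concat` this is `trajFeature`. -/
noncomputable def pathFeature (g : X → EuclideanSpace ℝ (Fin d)) (γ : ℝ)
    (θ : Fin D → EuclideanSpace ℝ (Fin d) × ℝ) (τ : ℕ → X) : EuclideanSpace ℝ (Fin D) :=
  discountedSum γ fun t => fourierFeature θ (g (τ t))

/-- The feature `(1 - γ) ∑_{t < T} γᵗ φ(g(τₜ))` of a trajectory truncated to its first `T` steps;
with `g = concat` this is `truncTrajFeature`. -/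
noncomputable def truncPathFeature (g : X → EuclideanSpace ℝ (Fin d)) (γ : ℝ) (T : ℕ)
    (θ : Fin D → EuclideanSpace ℝ (Fin d) × ℝ) (τ : ℕ → X) : EuclideanSpace ℝ (Fin D) :=
  truncDiscountedSum γ T fun t => fourierFeature θ (g (τ t))

variable {g : X → EuclideanSpace ℝ (Fin d)} {γ : ℝ}

theorem norm_pathFeature_le (hγ : 0 ≤ γ) (hγ' : γ < 1)
    (θ : Fin D → EuclideanSpace ℝ (Fin d) × ℝ) (τ : ℕ → X) : ‖pathFeature g γ θ τ‖ ≤ √2 :=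
  norm_discountedSum_le hγ hγ' fun _ => norm_fourierFeature_le θ _

theorem norm_pathFeature_sub_truncPathFeature_le (hγ : 0 ≤ γ) (hγ' : γ < 1) (T : ℕ)
    (θ : Fin D → EuclideanSpace ℝ (Fin d) × ℝ) (τ : ℕ → X) :
    ‖pathFeature g γ θ τ - truncPathFeature g γ T θ τ‖ ≤ γ ^ T * √2 :=
  norm_discountedSum_sub_truncDiscountedSum_le hγ hγ' (fun _ => norm_fourierFeature_le θ _) T

theorem norm_sampleMean_pathFeature_sub_truncPathFeature_le (hγ : 0 ≤ γ) (hγ' : γ < 1) (T : ℕ)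
    (θ : Fin D → EuclideanSpace ℝ (Fin d) × ℝ) {n : ℕ} (τ : Fin n → ℕ → X) :
    ‖sampleMean (fun j => pathFeature g γ θ (τ j))
      - sampleMean (fun j => truncPathFeature g γ T θ (τ j))‖ ≤ γ ^ T * √2 := by
  rw [sampleMean_sub]
  exact norm_sampleMean_le (by positivity) fun j =>
    norm_pathFeature_sub_truncPathFeature_le hγ hγ' T θ (τ j)

theorem norm_sampleMean_pathFeature_sub_le (hγ : 0 ≤ γ) (hγ' : γ < 1)
    (θ : Fin D → EuclideanSpace ℝ (Fin d) × ℝ) {n : ℕ} (τ₁ τ₂ : Fin n → ℕ → X) :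
    ‖sampleMean (fun j => pathFeature g γ θ (τ₁ j))
      - sampleMean (fun j => pathFeature g γ θ (τ₂ j))‖ ≤ 3 := by
  have norm_mean_le (τ : Fin n → ℕ → X) : ‖sampleMean fun j => pathFeature g γ θ (τ j)‖ ≤ √2 :=
    norm_sampleMean_le (Real.sqrt_nonneg 2) fun j => norm_pathFeature_le hγ hγ' θ (τ j)
  have hsqrt : √2 ≤ 3 / 2 := Real.sqrt_le_iff.2 (by norm_num)
  exact (norm_sub_le _ _).trans (by linarith [norm_mean_le τ₁, norm_mean_le τ₂])

theorem abs_norm_sampleMean_truncPathFeature_sub_sub_le (hγ : 0 ≤ γ) (hγ' : γ < 1) (T : ℕ) (b : ℝ)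
    (θ : Fin D → EuclideanSpace ℝ (Fin d) × ℝ) {n : ℕ} (τ₁ τ₂ : Fin n → ℕ → X) :
    |‖sampleMean (fun j => truncPathFeature g γ T θ (τ₁ j))
        - sampleMean (fun j => truncPathFeature g γ T θ (τ₂ j))‖ - b|
      ≤ |‖sampleMean (fun j => pathFeature g γ θ (τ₁ j))
        - sampleMean (fun j => pathFeature g γ θ (τ₂ j))‖ - b| + 2 * √2 * γ ^ T := by
  refine (abs_norm_sub_le_add_norm_sub _ (sampleMean (fun j => pathFeature g γ θ (τ₁ j))
        - sampleMean (fun j => pathFeature g γ θ (τ₂ j))) b).trans ?_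
  gcongr
  rw [norm_sub_rev, sub_sub_sub_comm]
  refine (norm_sub_le _ _).trans ?_
  linarith [norm_sampleMean_pathFeature_sub_truncPathFeature_le (g := g) hγ hγ' T θ τ₁,
    norm_sampleMean_pathFeature_sub_truncPathFeature_le (g := g) hγ hγ' T θ τ₂]

variable [MeasurableSpace X]

theorem stronglyMeasurable_uncurry_pathFeature (hγ : 0 ≤ γ) (hγ' : γ < 1) (hg : Measurable g) :
    StronglyMeasurable (Function.uncurry (pathFeature (D := D) g γ)) := by
  refine stronglyMeasurable_discountedSum (K := √2) hγ hγ' (fun t => ?_)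
    fun y t => norm_fourierFeature_le y.1 _
  exact (measurable_uncurry_fourierFeature.comp (measurable_fst.prodMk
    (hg.comp ((measurable_pi_apply t).comp measurable_snd)))).stronglyMeasurable

theorem stronglyMeasurable_pathFeature (hγ : 0 ≤ γ) (hγ' : γ < 1) (hg : Measurable g)
    (θ : Fin D → EuclideanSpace ℝ (Fin d) × ℝ) : StronglyMeasurable (pathFeature g γ θ) :=
  stronglyMeasurable_discountedSum (K := √2) hγ hγ' (fun t =>
    (stronglyMeasurable_fourierFeature θ).comp_measurable (hg.comp (measurable_pi_apply t)))
    fun _ _ => norm_fourierFeature_le θ _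

theorem stronglyMeasurable_truncPathFeature (hg : Measurable g) (T : ℕ)
    (θ : Fin D → EuclideanSpace ℝ (Fin d) × ℝ) : StronglyMeasurable (truncPathFeature g γ T θ) :=
  stronglyMeasurable_truncDiscountedSum (fun t =>
    (stronglyMeasurable_fourierFeature θ).comp_measurable (hg.comp (measurable_pi_apply t))) T

variable (ν : Measure (ℕ → X)) [IsProbabilityMeasure ν]

theorem integral_pathFeature (hγ : 0 ≤ γ) (hγ' : γ < 1) (hg : Measurable g)
    (θ : Fin D → EuclideanSpace ℝ (Fin d) × ℝ) :
    ∫ τ, pathFeature g γ θ τ ∂ν = ∫ x, fourierFeature θ x ∂((discountedOccupancy γ ν).map g) := by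
  have hφ := stronglyMeasurable_fourierFeature θ
  have hocc := integral_discountedOccupancy (f := fun x => fourierFeature θ (g x)) ν hγ hγ'
    (hφ.comp_measurable hg) fun x => norm_fourierFeature_le θ (g x)
  rw [integral_map hg.aemeasurable hφ.aestronglyMeasurable]
  exact hocc.symm

theorem norm_integral_pathFeature_sub_integral_truncPathFeature_le (hγ : 0 ≤ γ) (hγ' : γ < 1)
    (hg : Measurable g) (T : ℕ) (θ : Fin D → EuclideanSpace ℝ (Fin d) × ℝ) :
    ‖(∫ τ, pathFeature g γ θ τ ∂ν) - ∫ τ, truncPathFeature g γ T θ τ ∂ν‖ ≤ γ ^ T * √2 := by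
  have hbias := norm_pathFeature_sub_truncPathFeature_le (g := g) hγ hγ' T θ
  have hz : Integrable (pathFeature g γ θ) ν :=
    .of_bound (stronglyMeasurable_pathFeature hγ hγ' hg θ).aestronglyMeasurable _
      (.of_forall (norm_pathFeature_le hγ hγ' θ))
  have hdiff : Integrable (fun τ => pathFeature g γ θ τ - truncPathFeature g γ T θ τ) ν :=
    .of_bound ((stronglyMeasurable_pathFeature hγ hγ' hg θ).sub
      (stronglyMeasurable_truncPathFeature hg T θ)).aestronglyMeasurable _ (.of_forall hbias)
  have hzT : Integrable (truncPathFeature g γ T θ) ν := by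
    simpa only [Pi.sub_def, sub_sub_cancel] using hz.sub hdiff
  exact norm_integral_sub_integral_le_of_forall_norm_sub_le hz hzT hbias

end PathFeatures

theorem measureReal_prod_le_of_forall_slice_le {X Y : Type*} [MeasurableSpace X] [MeasurableSpace Y]
    (μ : Measure X) (ν : Measure Y) [IsProbabilityMeasure μ] [IsProbabilityMeasure ν]
    {s : Set (X × Y)} (hs : MeasurableSet s) {c : ℝ} (h : ∀ x, ν.real (Prod.mk x ⁻¹' s) ≤ c) :
    (μ.prod ν).real s ≤ c := by
  have hc : 0 ≤ c := measureReal_nonneg.trans (h μ.nonempty_of_neZero.some)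
  refine ENNReal.toReal_le_of_le_ofReal hc ?_
  rw [Measure.prod_apply hs]
  calc ∫⁻ x, ν (Prod.mk x ⁻¹' s) ∂μ ≤ ∫⁻ _, ENNReal.ofReal c ∂μ :=
        lintegral_mono fun x => (ENNReal.le_ofReal_iff_toReal_le (measure_ne_top _ _) hc).2 (h x)
    _ = ENNReal.ofReal c := by rw [lintegral_const, measure_univ, mul_one]

section SamplingLaw

variable {X : Type*} [MeasurableSpace X] {d D n : ℕ} {g : X → EuclideanSpace ℝ (Fin d)} {γ ε : ℝ}

/-- The joint law of `D` feature parameters and of two samples of `n` trajectories with laws `ν₁`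
and `ν₂`, all independent. -/
noncomputable abbrev samplingLaw (D n d : ℕ) (σ : ℝ) (ν₁ ν₂ : Measure (ℕ → X)) :
    Measure ((Fin D → EuclideanSpace ℝ (Fin d) × ℝ) × (Fin n → ℕ → X) × (Fin n → ℕ → X)) :=
  (Measure.pi fun _ => featureLaw d σ).prod ((Measure.pi fun _ => ν₁).prod (Measure.pi fun _ => ν₂))

variable (σ : ℝ) (ν₁ ν₂ : Measure (ℕ → X)) [IsProbabilityMeasure ν₁] [IsProbabilityMeasure ν₂]

theorem measureReal_norm_sampleMean_pathFeature_sub_integral_ge_le (hγ : 0 ≤ γ) (hγ' : γ < 1)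
    (hg : Measurable g) (hε : 0 < ε) (hnε : 128 ≤ n * ε ^ 2)
    (θ : Fin D → EuclideanSpace ℝ (Fin d) × ℝ) :
    ((Measure.pi fun _ : Fin n => ν₁).prod (Measure.pi fun _ : Fin n => ν₂)).real
        {τ | 9 / 4 * ε ≤ ‖(sampleMean (fun j => pathFeature g γ θ (τ.1 j))
            - sampleMean (fun j => pathFeature g γ θ (τ.2 j)))
          - ((∫ τ, pathFeature g γ θ τ ∂ν₁) - ∫ τ, pathFeature g γ θ τ ∂ν₂)‖}
      ≤ 2 * Real.exp (-(n * ε ^ 2 / 4)) := by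
  have hn : n ≠ 0 := by
    rintro rfl
    norm_num at hnε
  have hsqrt : √2 / √n ≤ ε / 8 := by
    have hn' : (0 : ℝ) < n := Nat.cast_pos.2 (Nat.pos_of_ne_zero hn)
    rw [← Real.sqrt_div zero_le_two, Real.sqrt_le_left (by positivity), div_pow,
      div_le_div_iff₀ hn' (by norm_num)]
    linarith
  have hz := stronglyMeasurable_pathFeature hγ hγ' hg θ
  have hK := norm_pathFeature_le (g := g) hγ hγ' θ
  have hconc := measureReal_norm_sampleMean_sub_sampleMean_sub_ge_le ν₁ ν₂ hz hK hz hK hn hε.le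
  rw [Real.sq_sqrt zero_le_two, neg_div, show (2 * 2 : ℝ) = 4 by norm_num] at hconc
  refine (measureReal_mono fun τ hτ => ?_).trans hconc
  rw [Set.mem_ofPred_eq] at hτ ⊢
  linarith

theorem measurable_norm_sampleMean_pathFeature_sub_integral (hγ : 0 ≤ γ) (hγ' : γ < 1)
    (hg : Measurable g) :
    Measurable fun y : (Fin D → EuclideanSpace ℝ (Fin d) × ℝ) × (Fin n → ℕ → X) × (Fin n → ℕ → X) =>
      ‖(sampleMean (fun j => pathFeature g γ y.1 (y.2.1 j))
          - sampleMean (fun j => pathFeature g γ y.1 (y.2.2 j)))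
        - ((∫ τ, pathFeature g γ y.1 τ ∂ν₁) - ∫ τ, pathFeature g γ y.1 τ ∂ν₂)‖ := by
  have hz := stronglyMeasurable_uncurry_pathFeature (D := D) hγ hγ' hg
  have measurable_mean (ν : Measure (ℕ → X)) [IsProbabilityMeasure ν] :
      Measurable fun θ : Fin D → EuclideanSpace ℝ (Fin d) × ℝ => ∫ τ, pathFeature g γ θ τ ∂ν :=
    hz.integral_prod_right.measurable
  have measurable_sample {τ : (Fin D → EuclideanSpace ℝ (Fin d) × ℝ) ×
      (Fin n → ℕ → X) × (Fin n → ℕ → X) → Fin n → ℕ → X} (hτ : Measurable τ) :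
      Measurable fun y => sampleMean fun j => pathFeature g γ y.1 (τ y j) :=
    (stronglyMeasurable_sampleMean fun j => hz.comp_measurable
      (measurable_fst.prodMk ((measurable_pi_apply j).comp hτ))).measurable
  have measurable_sampleGap := (measurable_sample (τ := fun y => y.2.1) measurable_snd.fst).sub
    (measurable_sample (τ := fun y => y.2.2) measurable_snd.snd)
  exact (measurable_sampleGap.sub
    (((measurable_mean ν₁).sub (measurable_mean ν₂)).comp measurable_fst)).norm

theorem measureReal_abs_norm_integral_pathFeature_sub_sub_gaussianMMD_ge_le (hγ : 0 ≤ γ)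
    (hγ' : γ < 1) (hg : Measurable g) (hD : D ≠ 0) (hε : 0 < ε) :
    (Measure.pi fun _ : Fin D => featureLaw d σ).real {θ | ε / 2 ≤
        |‖(∫ τ, pathFeature g γ θ τ ∂ν₁) - ∫ τ, pathFeature g γ θ τ ∂ν₂‖
          - gaussianMMD σ ((discountedOccupancy γ ν₁).map g) ((discountedOccupancy γ ν₂).map g)|}
      ≤ 2 * Real.exp (-(D * ε ^ 2 / 128)) := by
  have := isProbabilityMeasure_discountedOccupancy ν₁ hγ hγ'
  have := isProbabilityMeasure_discountedOccupancy ν₂ hγ hγ'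
  have := Measure.isProbabilityMeasure_map (μ := discountedOccupancy γ ν₁) hg.aemeasurable
  have := Measure.isProbabilityMeasure_map (μ := discountedOccupancy γ ν₂) hg.aemeasurable
  simp only [integral_pathFeature _ hγ hγ' hg]
  refine (measureReal_abs_norm_integral_fourierFeature_sub_sub_gaussianMMD_ge_le σ _ _ hD
    (half_pos hε)).trans_eq ?_
  ring_nf

theorem measureReal_samplingLaw_abs_norm_sub_sub_gaussianMMD_ge_le (hγ : 0 ≤ γ) (hγ' : γ < 1)
    (hg : Measurable g) (hD : D ≠ 0) (hε : 0 < ε) (hnε : 128 ≤ n * ε ^ 2) :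
    (samplingLaw D n d σ ν₁ ν₂).real {y | 11 / 4 * ε ≤
        |‖sampleMean (fun j => pathFeature g γ y.1 (y.2.1 j))
            - sampleMean (fun j => pathFeature g γ y.1 (y.2.2 j))‖
          - gaussianMMD σ ((discountedOccupancy γ ν₁).map g) ((discountedOccupancy γ ν₂).map g)|}
      ≤ 2 * Real.exp (-(D * ε ^ 2 / 128)) + 2 * Real.exp (-(n * ε ^ 2 / 4)) := by
  set meanGap := fun θ : Fin D → EuclideanSpace ℝ (Fin d) × ℝ =>
    (∫ τ, pathFeature g γ θ τ ∂ν₁) - ∫ τ, pathFeature g γ θ τ ∂ν₂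
  set sampleGap := fun y : (Fin D → EuclideanSpace ℝ (Fin d) × ℝ) × (Fin n → ℕ → X) ×
      (Fin n → ℕ → X) => sampleMean (fun j => pathFeature g γ y.1 (y.2.1 j))
    - sampleMean (fun j => pathFeature g γ y.1 (y.2.2 j))
  set mmd := gaussianMMD σ ((discountedOccupancy γ ν₁).map g) ((discountedOccupancy γ ν₂).map g)
  set featureError := {θ | ε / 2 ≤ |‖meanGap θ‖ - mmd|}
  set sampleError := {y | 9 / 4 * ε ≤ ‖sampleGap y - meanGap y.1‖}
  have featureError_le : (samplingLaw D n d σ ν₁ ν₂).real (featureError ×ˢ Set.univ)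
      ≤ 2 * Real.exp (-(D * ε ^ 2 / 128)) := by
    rw [measureReal_prod_prod, probReal_univ, mul_one]
    exact
      measureReal_abs_norm_integral_pathFeature_sub_sub_gaussianMMD_ge_le σ ν₁ ν₂ hγ hγ' hg hD hε
  have sampleError_le : (samplingLaw D n d σ ν₁ ν₂).real sampleError
      ≤ 2 * Real.exp (-(n * ε ^ 2 / 4)) :=
    measureReal_prod_le_of_forall_slice_le _ _ (measurableSet_le measurable_const
      (measurable_norm_sampleMean_pathFeature_sub_integral ν₁ ν₂ hγ hγ' hg))
      (measureReal_norm_sampleMean_pathFeature_sub_integral_ge_le ν₁ ν₂ hγ hγ' hg hε hnε)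
  refine (measureReal_mono fun y hy => ?_).trans
    ((measureReal_union_le (featureError ×ˢ Set.univ) sampleError).trans
      (add_le_add featureError_le sampleError_le))
  by_contra hout
  simp only [featureError, sampleError, Set.mem_union, Set.mem_prod, Set.mem_univ, and_true,
    Set.mem_ofPred_eq, not_or, not_le] at hout hy
  linarith [abs_norm_sub_le_add_norm_sub (sampleGap y) (meanGap y.1) mmd]

end SamplingLaw

section TailBound

variable {n D d : ℕ} {ε : ℝ}

theorem one_le_tailBound (hnε : n * ε ^ 2 ≤ 128) : 1 ≤ tailBound 1 8 n D d ε := by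
  have exp_two_le : Real.exp 2 ≤ 8 := by
    calc Real.exp 2 = Real.exp 1 ^ 2 := by rw [← Real.exp_nat_mul]; norm_num
      _ ≤ 2.7182818286 ^ 2 := pow_le_pow_left₀ (Real.exp_pos 1).le Real.exp_one_lt_d9.le 2
      _ ≤ 8 := by norm_num
  calc (1 : ℝ) = Real.exp 2 * Real.exp (-2) := by rw [← Real.exp_add, add_neg_cancel, Real.exp_zero]
    _ ≤ 8 * Real.exp (-(n * ε ^ 2) / 64) := by gcongr; linarith
    _ ≤ tailBound 1 8 n D d ε := le_add_of_nonneg_left (by positivity)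

theorem feature_error_add_sample_error_le_tailBound (hε : 0 < ε) (hε2 : ε ≤ 2) :
    2 * Real.exp (-(D * ε ^ 2 / 128)) + 2 * Real.exp (-(n * ε ^ 2 / 4))
      ≤ tailBound 1 8 n D d ε := by
  have feature_term : 2 * Real.exp (-(D * ε ^ 2 / 128))
      ≤ 8 * (1 / ε ^ 2 * Real.exp (-(D * ε ^ 2) / (64 * (d + 2)))) := by
    have hsq : 1 / 4 ≤ 1 / ε ^ 2 :=
      one_div_le_one_div_of_le (by positivity) (by nlinarith)
    calc 2 * Real.exp (-(D * ε ^ 2 / 128))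
        = 8 * (1 / 4 * Real.exp (-(D * ε ^ 2) / 128)) := by rw [neg_div]; ring
      _ ≤ 8 * (1 / ε ^ 2 * Real.exp (-(D * ε ^ 2) / (64 * (d + 2)))) := by
        rw [neg_div, neg_div]
        gcongr
        linarith [d.cast_nonneg (α := ℝ)]
  have sample_term : 2 * Real.exp (-(n * ε ^ 2 / 4)) ≤ 6 * Real.exp (-(n * ε ^ 2) / 8) := by
    rw [neg_div]
    gcongr <;> norm_num
  have first_term : 0 ≤ 2 * Real.exp (-(n * 1 * ε ^ 2)) := by positivity
  have last_term : 0 ≤ 8 * Real.exp (-(n * ε ^ 2) / 64) := by positivity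
  unfold tailBound
  linarith

end TailBound

section Concentration

variable {X : Type*} [MeasurableSpace X] {d D n : ℕ} {g : X → EuclideanSpace ℝ (Fin d)} {γ : ℝ}
  (σ : ℝ) (ν₁ ν₂ : Measure (ℕ → X)) [IsProbabilityMeasure ν₁] [IsProbabilityMeasure ν₂]

theorem abs_norm_sampleMean_pathFeature_sub_sub_gaussianMMD_le (hγ : 0 ≤ γ) (hγ' : γ < 1)
    (hg : Measurable g) (θ : Fin D → EuclideanSpace ℝ (Fin d) × ℝ) (τ₁ τ₂ : Fin n → ℕ → X) :
    |‖sampleMean (fun j => pathFeature g γ θ (τ₁ j))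
        - sampleMean (fun j => pathFeature g γ θ (τ₂ j))‖
      - gaussianMMD σ ((discountedOccupancy γ ν₁).map g) ((discountedOccupancy γ ν₂).map g)| ≤
        3 := by
  have := isProbabilityMeasure_discountedOccupancy ν₁ hγ hγ'
  have := isProbabilityMeasure_discountedOccupancy ν₂ hγ hγ'
  have := Measure.isProbabilityMeasure_map (μ := discountedOccupancy γ ν₁) hg.aemeasurable
  have := Measure.isProbabilityMeasure_map (μ := discountedOccupancy γ ν₂) hg.aemeasurable
  have hmmd := gaussianMMD_le_two σ ((discountedOccupancy γ ν₁).map g)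
    ((discountedOccupancy γ ν₂).map g)
  exact abs_sub_le_of_nonneg_of_le (norm_nonneg _)
    (norm_sampleMean_pathFeature_sub_le hγ hγ' θ τ₁ τ₂) (norm_nonneg _) (hmmd.trans (by norm_num))

variable {Ω : Type*} [MeasurableSpace Ω] (μ : Measure Ω) [IsProbabilityMeasure μ]
  (θ : Ω → Fin D → EuclideanSpace ℝ (Fin d) × ℝ) (τ₁ τ₂ : Ω → Fin n → ℕ → X)

theorem measureReal_abs_norm_sampleMean_pathFeature_sub_sub_gaussianMMD_ge_le (hγ : 0 ≤ γ)
    (hγ' : γ < 1) (hg : Measurable g) (hD : D ≠ 0) {ε : ℝ} (hε : 0 < ε)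
    (hlaw : HasLaw (fun ω => (θ ω, τ₁ ω, τ₂ ω)) (samplingLaw D n d σ ν₁ ν₂) μ) :
    μ.real {ω | 11 / 4 * ε ≤
        |‖sampleMean (fun j => pathFeature g γ (θ ω) (τ₁ ω j))
            - sampleMean (fun j => pathFeature g γ (θ ω) (τ₂ ω j))‖
          - gaussianMMD σ ((discountedOccupancy γ ν₁).map g) ((discountedOccupancy γ ν₂).map g)|}
      ≤ tailBound 1 8 n D d ε := by
  rcases le_total (n * ε ^ 2) 128 with hnε | hnε
  · exact measureReal_le_one.trans (one_le_tailBound hnε)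
  rcases le_or_gt ε 2 with hε2 | hε2
  · refine le_trans ?_ ((measureReal_samplingLaw_abs_norm_sub_sub_gaussianMMD_ge_le σ ν₁ ν₂
      hγ hγ' hg hD hε hnε).trans (feature_error_add_sample_error_le_tailBound hε hε2))
    rw [← hlaw.map_eq]
    exact ENNReal.toReal_mono (measure_ne_top _ _) (Measure.le_map_apply hlaw.aemeasurable _)
  · have deviation_lt (ω : Ω) := (abs_norm_sampleMean_pathFeature_sub_sub_gaussianMMD_le σ ν₁ ν₂
      hγ hγ' hg (θ ω) (τ₁ ω) (τ₂ ω)).trans_lt (show 3 < 11 / 4 * ε by linarith)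
    simp only [(deviation_lt _).not_ge, Set.ofPred_false, measureReal_empty]
    unfold tailBound
    positivity

end Concentration

theorem mainTheorem2_general {X : Type*} [MeasurableSpace X] {d D n : ℕ}
    {g : X → EuclideanSpace ℝ (Fin d)} {γ σ ε : ℝ} (hγ : 0 ≤ γ) (hγ' : γ < 1) (hg : Measurable g)
    (ν₁ ν₂ : Measure (ℕ → X)) [IsProbabilityMeasure ν₁] [IsProbabilityMeasure ν₂]
    (_ : 0 < σ) (_ : 1 ≤ n) (hD : 1 ≤ D) (hε : 0 < ε) {Ω : Type*} [MeasurableSpace Ω]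
    (μ : Measure Ω) [IsProbabilityMeasure μ] (θ : Ω → Fin D → EuclideanSpace ℝ (Fin d) × ℝ)
    (τ₁ τ₂ : Ω → Fin n → ℕ → X)
    (hlaw : HasLaw (fun ω => (θ ω, τ₁ ω, τ₂ ω)) (samplingLaw D n d σ ν₁ ν₂) μ) :
    μ.real {ω | 11 / 4 * ε ≤
        |‖sampleMean (fun j => pathFeature g γ (θ ω) (τ₁ ω j))
            - sampleMean (fun j => pathFeature g γ (θ ω) (τ₂ ω j))‖
          - gaussianMMD σ ((discountedOccupancy γ ν₁).map g) ((discountedOccupancy γ ν₂).map g)|}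
      ≤ tailBound 1 8 n D d ε ∧
    ∀ T : ℕ,
      μ.real {ω | 11 / 4 * ε + 2 * √2 * γ ^ T ≤
          |‖sampleMean (fun j => truncPathFeature g γ T (θ ω) (τ₁ ω j))
              - sampleMean (fun j => truncPathFeature g γ T (θ ω) (τ₂ ω j))‖
            - gaussianMMD σ ((discountedOccupancy γ ν₁).map g)
              ((discountedOccupancy γ ν₂).map g)|}
        ≤ tailBound 1 8 n D d ε ∧
      ∀ θ₀ : Fin D → EuclideanSpace ℝ (Fin d) × ℝ,
        ‖(∫ τ, pathFeature g γ θ₀ τ ∂ν₁) - ∫ τ, truncPathFeature g γ T θ₀ τ ∂ν₁‖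
          + ‖(∫ τ, pathFeature g γ θ₀ τ ∂ν₂) - ∫ τ, truncPathFeature g γ T θ₀ τ ∂ν₂‖
          ≤ 2 * √2 * γ ^ T := by
  have infinite_horizon := measureReal_abs_norm_sampleMean_pathFeature_sub_sub_gaussianMMD_ge_le σ
    ν₁ ν₂ μ θ τ₁ τ₂ hγ hγ' hg (Nat.one_le_iff_ne_zero.1 hD) hε hlaw
  refine ⟨infinite_horizon, fun T => ⟨(measureReal_mono fun ω hω => ?_).trans infinite_horizon,
    fun θ₀ => ?_⟩⟩
  · exact le_of_add_le_add_right (hω.trans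
      (abs_norm_sampleMean_truncPathFeature_sub_sub_le hγ hγ' T _ (θ ω) (τ₁ ω) (τ₂ ω)))
  · linarith [norm_integral_pathFeature_sub_integral_truncPathFeature_le ν₁ hγ hγ' hg T θ₀,
      norm_integral_pathFeature_sub_integral_truncPathFeature_le ν₂ hγ hγ' hg T θ₀]

theorem mainTheorem2 :
    ∃ c₁ : ℝ, 0 < c₁ ∧ ∃ C : ℝ, 0 < C ∧
      ∀ (p q : ℕ) (S : Set (EuclideanSpace ℝ (Fin p))) (A : Set (EuclideanSpace ℝ (Fin q)))
        (M : MDP S A) (π₁ π₂ : Kernel S A) [IsMarkovKernel π₁] [IsMarkovKernel π₂]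
        (σ : ℝ) (n D : ℕ) (ε : ℝ), 0 < σ → 1 ≤ n → 1 ≤ D → 0 < ε →
      ∀ {Ω : Type*} [MeasurableSpace Ω] (μ : Measure Ω) [IsProbabilityMeasure μ]
        (θ : Ω → Fin D → EuclideanSpace ℝ (Fin (p + q)) × ℝ)
        (τ₁ τ₂ : Ω → Fin n → ℕ → S × A),
        -- the feature parameters and the `n + n` trajectories are independent, with these laws
        HasLaw (fun ω => (θ ω, τ₁ ω, τ₂ ω))
          ((Measure.pi fun _ : Fin D => featureLaw (p + q) σ).prod
            ((Measure.pi fun _ : Fin n => M.trajectoryLaw π₁).prod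
              (Measure.pi fun _ : Fin n => M.trajectoryLaw π₂))) μ →
        -- infinite horizon
        μ.real {ω | 11 / 4 * ε ≤
            |‖embedding M.discount (θ ω) (τ₁ ω) - embedding M.discount (θ ω) (τ₂ ω)‖
              - gaussianMMD σ ((M.occupancy π₁).map concat) ((M.occupancy π₂).map concat)|}
          ≤ tailBound c₁ C n D (p + q) ε ∧
        -- finite horizon
        ∀ T : ℕ,
          μ.real {ω | 11 / 4 * ε + 2 * Real.sqrt 2 * M.discount ^ T ≤
              |‖truncEmbedding M.discount T (θ ω) (τ₁ ω)
                  - truncEmbedding M.discount T (θ ω) (τ₂ ω)‖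
                - gaussianMMD σ ((M.occupancy π₁).map concat) ((M.occupancy π₂).map concat)|}
            ≤ tailBound c₁ C n D (p + q) ε ∧
          -- the truncation bias, for every realization of the feature parameters
          ∀ θ₀ : Fin D → EuclideanSpace ℝ (Fin (p + q)) × ℝ,
            ‖(∫ τ, trajFeature M.discount θ₀ τ ∂(M.trajectoryLaw π₁))
                - ∫ τ, truncTrajFeature M.discount T θ₀ τ ∂(M.trajectoryLaw π₁)‖
              + ‖(∫ τ, trajFeature M.discount θ₀ τ ∂(M.trajectoryLaw π₂))
                - ∫ τ, truncTrajFeature M.discount T θ₀ τ ∂(M.trajectoryLaw π₂)‖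
              ≤ 2 * Real.sqrt 2 * M.discount ^ T :=
  ⟨1, one_pos, 8, by norm_num, fun _ _ _ _ M π₁ π₂ _ _ _ _ _ _ hσ hn hD hε _ _ μ _ θ τ₁ τ₂ hlaw =>
    mainTheorem2_general M.discount_pos.le M.discount_lt_one measurable_concat (M.trajectoryLaw π₁)
      (M.trajectoryLaw π₂) hσ hn hD hε μ θ τ₁ τ₂ hlaw⟩
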